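/- Let $W_0=\{(u_1,v_1,u_2,v_2,z)\in\mathbb{C}^5 : u_1v_1=z^2-1,\ u_2v_2=z\}$ (equivalently the affine quartic $u_1v_1=(u_2v_2)^2-1$ in $\mathbb{C}^4$), with the Stein form $\omega_0$ restricted from the standard Kähler form of $\mathbb{C}^5$. This is the plumbing of two copies of $T^*S^3$ along a circle. The projection $\pi=z:W_0\to\mathbb{C}$ is a Morse--Bott--Lefschetz fibration with general fibre $(\mathbb{C}^*)^2$ and critical values $-1,0,1$, over which the first, the second and the first circle factor of the fibre are collapsed (vanishing cycles $a,b,a$). For $t\in\mathbb{R}$ deform $\omega_0$ by the translation by $t$ of the first factor $\mathbb{C}^*=\mathbb{R}\times S^1$ of the fibre across a vertical line in the base between $0$ and $1$. Explicitly, write $z=x+iy$, $\theta=\tfrac12(\arg u_1-\arg v_1)$, let $\sigma:\mathbb{R}\to[0,1]$ be the smooth step function $\sigma(s)=\frac{h(s)}{h(s)+h(1-s)}$, where $h(s)=e^{-1/s}$ for $s>0$ and $h(s)=0$ for $s\le0$, and let $\chi(x)=\sigma(2x-\tfrac12)$, so that $\chi=0$ for $x\le\frac14$ and $\chi=1$ for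 $x\ge\frac34$. Put $$\omega_t=\omega_0+t\,d\chi(x)\wedge d\theta+8\,(t\chi'(x))^2\,dx\wedge dy ,$$ where $u_1v_1\ne0$ on the part of $W_0$ over the support of $\chi'$; the last term is exact and pulled back from the base. For a path $\gamma$ in $\mathbb{C}$ between two critical values, the matching cycle of $\gamma$ is the union of all continuous lifts of $\gamma$ to $W_0$ which, over the interior of $\gamma$, are differentiable with velocity $\omega_t$-orthogonal to the fibres of $\pi$, and which start and end at critical points of $\pi$. The core spheres $L_-$ and $L_+$ of $(W_0,\omega_t)$ are the matching cycles of the segments $[-1,0]$ and $[0,1]$. Let $t\neq 0$. Then: 1. $\omega_t$ is a symplectic form on $W_0$, and it is not exact; 2. $L_-$ and $L_+$ are (smoothly embedded) Lagrangian 3-spheres in $(W_0,\omega_t)$; 3. $L_-\cap L_+=\emptyset$; 4. the critical locus $\{u_1v_1=-1,\ u_2=v_2=z=0\}$ of the central fibre $\pi^{-1}(0)$ is symplectomorphic to $(\mathbb{R}\times S^1,\,dr\wedge d\theta)$ by the parametrisation $u_1=e^{\operatorname{arsinh}(r)/2}e^{i\theta}$, $v_1=-u_1^{-1}$; in this cylinder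 $L_-\cap\pi^{-1}(0)$ is the circle $\{0\}\times S^1$, and $L_+\cap\pi^{-1}(0)$ is its image $\{t\}\times S^1$ under the translation $(r,\theta)\mapsto(r+t,\theta)$, which has flux $t\,[d\theta]$. -/

import Mathlib

open scoped Manifold ContDiff

noncomputable section

namespace InexactPlumbing

/-! ## The affine threefold and its fibration over the plane -/

/-- The ambient space `ℂ⁵`, with coordinates `(u₁, v₁, u₂, v₂, z) = (w 0, w 1, w 2, w 3, w 4)`,
regarded as a real vector space. -/
abbrev Amb : Type := Fin 5 → ℂ

/-- The affine variety `u₁ v₁ = z² - 1`, `u₂ v₂ = z` (equivalently, the affine quartic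
`u₁ v₁ = (u₂ v₂)² - 1` in `ℂ⁴`).  The projection to `z` is its Morse-Bott-Lefschetz fibration:
the general fibre is `ℂˣ × ℂˣ`, and the first, second, first circle factor is collapsed over the
critical values `z = -1, 0, 1` respectively. -/
def W₀ : Set Amb := {w | w 0 * w 1 = w 4 ^ 2 - 1 ∧ w 2 * w 3 = w 4}

/-- The tangent space of `W₀` at `w`: the common kernel of the differentials of the two
equations (which are linearly independent at every point of `W₀`). -/
def tangent (w : Amb) : Submodule ℝ Amb where
  carrier := {ξ | ξ 0 * w 1 + w 0 * ξ 1 = 2 * w 4 * ξ 4 ∧ ξ 2 * w 3 + w 2 * ξ 3 = ξ 4}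
  add_mem' := by
    rintro a b ⟨ha, ha'⟩ ⟨hb, hb'⟩
    constructor
    · simp only [Pi.add_apply]; linear_combination ha + hb
    · simp only [Pi.add_apply]; linear_combination ha' + hb'
  zero_mem' := by simp
  smul_mem' := by
    rintro c a ⟨ha, ha'⟩
    constructor
    · simp only [Pi.smul_apply, Complex.real_smul]; linear_combination (c : ℂ) * ha
    · simp only [Pi.smul_apply, Complex.real_smul]; linear_combination (c : ℂ) * ha'

/-- The fibre of `z : W₀ → ℂ` over `ζ`. -/
def fibre (ζ : ℂ) : Set Amb := {w | w ∈ W₀ ∧ w 4 = ζ}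

/-- The critical points of `z : W₀ → ℂ`: the points where `dz` vanishes on the tangent space. -/
def criticalSet : Set Amb := {w | w ∈ W₀ ∧ ∀ ξ ∈ tangent w, ξ 4 = 0}

/-! ## Differential forms -/

/-- The wedge product `α ∧ β` of two real covectors. -/
def wedge (α β : Amb →L[ℝ] ℝ) : Amb [⋀^Fin 2]→L[ℝ] ℝ where
  toFun v := α (v 0) * β (v 1) - α (v 1) * β (v 0)
  map_update_add' v i x y := by
    fin_cases i
    all_goals simp [Function.update, map_add]
    all_goals ring
  map_update_smul' v i c x := by
    fin_cases i
    all_goals simp [Function.update]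
    all_goals ring
  map_eq_zero_of_eq' v i j h hij := by
    fin_cases i <;> fin_cases j <;> simp_all
  cont := by fun_prop

/-- The real part of the `j`-th coordinate. -/
def reC (j : Fin 5) : Amb →L[ℝ] ℝ := Complex.reCLM ∘L ContinuousLinearMap.proj j

/-- The imaginary part of the `j`-th coordinate. -/
def imC (j : Fin 5) : Amb →L[ℝ] ℝ := Complex.imCLM ∘L ContinuousLinearMap.proj j

/-- The standard Kähler form `∑ⱼ dxⱼ ∧ dyⱼ` of `ℂ⁵`; its restriction to `W₀` is the Stein form
`ω₀`. -/
def omegaStd : Amb [⋀^Fin 2]→L[ℝ] ℝ := ∑ j, wedge (reC j) (imC j)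

/-- The angular form `dθ` of the first factor of the fibre, where `θ = (arg u₁ - arg v₁) / 2`.
It is only meaningful where `u₁ v₁ ≠ 0`. -/
def dTheta (w : Amb) : Amb →L[ℝ] ℝ :=
  (1 / 2 : ℝ) • (Complex.imCLM ∘L
    ((w 0)⁻¹ • (ContinuousLinearMap.proj 0 : Amb →L[ℝ] ℂ)
      - (w 1)⁻¹ • (ContinuousLinearMap.proj 1 : Amb →L[ℝ] ℂ)))

/-- A smooth function on the line, equal to `0` for `x ≤ 1/4` and to `1` for `x ≥ 3/4`. -/
def cutoff (x : ℝ) : ℝ := Real.smoothTransition (2 * x - 1 / 2)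

/-- The deformed form
`ω_t = ω₀ + t d(χ(x)) ∧ dθ + 8 (t χ'(x))² dx ∧ dy`, where `z = x + i y` and `χ` is the cutoff.
The second term is the smooth form of cutting `W₀` along the preimage of a vertical line between
the critical values `0` and `1` and regluing by the translation by `t` of the first factor
`ℂˣ = ℝ × S¹` of the fibre; it lives in the strip `1/4 ≤ x ≤ 3/4`, over which `u₁ v₁ ≠ 0` on `W₀`.
The last term is pulled back from the base and exact; it keeps the form nondegenerate and changes
neither its restriction to the fibres nor parallel transport. -/
def omega (t : ℝ) (w : Amb) : Amb [⋀^Fin 2]→L[ℝ] ℝ :=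
  omegaStd + (t * deriv cutoff (w 4).re) • wedge (reC 4) (dTheta w)
    + (8 * (t * deriv cutoff (w 4).re) ^ 2) • wedge (reC 4) (imC 4)

/-- `Ω` restricts to a symplectic form on `W₀`: it is smooth, and its restriction to `W₀` is closed
and nondegenerate. -/
structure IsSymplectic (Ω : Amb → Amb [⋀^Fin 2]→L[ℝ] ℝ) : Prop where
  smooth : ∀ w ∈ W₀, ContDiffAt ℝ ∞ Ω w
  closed : ∀ w ∈ W₀, ∀ a ∈ tangent w, ∀ b ∈ tangent w, ∀ c ∈ tangent w,
    extDeriv Ω w ![a, b, c] = 0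
  nondegenerate : ∀ w ∈ W₀, ∀ a ∈ tangent w, (∀ b ∈ tangent w, Ω w ![a, b] = 0) → a = 0

/-- The restriction of `Ω` to `W₀` has a smooth primitive on `W₀`. -/
def IsExact (Ω : Amb → Amb [⋀^Fin 2]→L[ℝ] ℝ) : Prop :=
  ∃ α : Amb → Amb [⋀^Fin 1]→L[ℝ] ℝ, (∀ w ∈ W₀, ContDiffAt ℝ ∞ α w) ∧
    ∀ w ∈ W₀, ∀ a ∈ tangent w, ∀ b ∈ tangent w, extDeriv α w ![a, b] = Ω w ![a, b]

/-! ## Symplectic parallel transport and matching cycles -/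

/-- A tangent vector of `W₀` is horizontal if it is `Ω`-orthogonal to the tangent space of the
fibre of `z`. -/
def IsHorizontal (Ω : Amb → Amb [⋀^Fin 2]→L[ℝ] ℝ) (w ξ : Amb) : Prop :=
  ξ ∈ tangent w ∧ ∀ η ∈ tangent w, η 4 = 0 → Ω w ![ξ, η] = 0

/-- `c` is a lift to `W₀` of the path `γ : [0, 1] → ℂ` by symplectic parallel transport over the
interior of the path, extending continuously to the two ends. -/
structure IsHorizontalLift (Ω : Amb → Amb [⋀^Fin 2]→L[ℝ] ℝ) (γ : ℝ → ℂ) (c : ℝ → Amb) :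
    Prop where
  continuousOn : ContinuousOn c (Set.Icc 0 1)
  lifts : ∀ s ∈ Set.Icc (0 : ℝ) 1, c s ∈ fibre (γ s)
  horizontal : ∀ s ∈ Set.Ioo (0 : ℝ) 1, ∃ ξ, HasDerivAt c ξ s ∧ IsHorizontal Ω (c s) ξ

/-- The matching cycle of a path `γ` between two critical values: the set swept out by the
horizontal lifts of `γ` which run into the critical set at both ends.  Over an interior point of
`γ` it is the intersection of the vanishing cycles of the two ends. -/
def matchingCycle (Ω : Amb → Amb [⋀^Fin 2]→L[ℝ] ℝ) (γ : ℝ → ℂ) : Set Amb :=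
  {w | ∃ c : ℝ → Amb, IsHorizontalLift Ω γ c ∧ c 0 ∈ criticalSet ∧ c 1 ∈ criticalSet ∧
    ∃ s ∈ Set.Icc (0 : ℝ) 1, c s = w}

/-- The core of the plumbing over the segment from `-1` to `0`. -/
def coreLeft (Ω : Amb → Amb [⋀^Fin 2]→L[ℝ] ℝ) : Set Amb :=
  matchingCycle Ω (fun s => (s : ℂ) - 1)

/-- The core of the plumbing over the segment from `0` to `1`. -/
def coreRight (Ω : Amb → Amb [⋀^Fin 2]→L[ℝ] ℝ) : Set Amb :=
  matchingCycle Ω (fun s => (s : ℂ))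

/-- The unit sphere of `ℝ⁴`. -/
abbrev Sphere3 : Type := Metric.sphere (0 : EuclideanSpace ℝ (Fin 4)) 1

/-- `L` is a Lagrangian 3-sphere in `W₀` (of real dimension 6): the image of a smooth embedding
(an injective immersion of the compact manifold `S³`) along which `Ω` vanishes. -/
def IsLagrangianSphere (Ω : Amb → Amb [⋀^Fin 2]→L[ℝ] ℝ) (L : Set Amb) : Prop :=
  L ⊆ W₀ ∧ ∃ f : Sphere3 → Amb,
    ContMDiff (𝓡 3) 𝓘(ℝ, Amb) ∞ f ∧ Function.Injective f ∧
    (∀ x, Function.Injective (mfderiv (𝓡 3) 𝓘(ℝ, Amb) f x)) ∧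
    Set.range f = L ∧
    ∀ (x : Sphere3) (a b : TangentSpace (𝓡 3) x),
      Ω (f x) ![mfderiv (𝓡 3) 𝓘(ℝ, Amb) f x a, mfderiv (𝓡 3) 𝓘(ℝ, Amb) f x b] = 0

/-! ## The critical cylinder of the central fibre -/

/-- The parametrisation by `ℝ × S¹` of the curve `u₁ v₁ = -1`, `u₂ = v₂ = z = 0`,
for which `(|u₁|² - |v₁|²) / 2` is the coordinate of the factor `ℝ`. -/
def cyl (p : ℝ × Circle) : Amb :=
  ![(Real.exp (Real.arsinh p.1 / 2) : ℂ) * (p.2 : ℂ),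
    -((Real.exp (-(Real.arsinh p.1 / 2)) : ℂ) * ((p.2⁻¹ : Circle) : ℂ)), 0, 0, 0]

/-- `cyl` is a symplectic parametrisation, by `ℝ × S¹` with the form `dr ∧ dθ`, of the critical
locus of the central fibre. -/
structure IsSymplecticCylinder (Ω : Amb → Amb [⋀^Fin 2]→L[ℝ] ℝ) : Prop where
  bijOn : Set.BijOn cyl Set.univ (criticalSet ∩ fibre 0)
  smooth : ContDiff ℝ ∞ (fun q : ℝ × ℝ => cyl (q.1, Circle.exp q.2))
  area : ∀ r θ : ℝ, Ω (cyl (r, Circle.exp θ))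
    ![deriv (fun r' => cyl (r', Circle.exp θ)) r, deriv (fun θ' => cyl (r, Circle.exp θ')) θ] = 1

/-- The translation by `t` in the factor `ℝ` of `(ℝ × S¹, dr ∧ dθ)`: the symplectomorphism with
flux `t • [dθ]`. -/
def fluxTranslation (t : ℝ) (p : ℝ × Circle) : ℝ × Circle := (p.1 + t, p.2)

end InexactPlumbing

end

/-!
The two circle factors of the fibre `ℂˣ × ℂˣ` rotate `W₀`, and the functions `|u₁|² - |v₁|²` and
`|u₂|² - |v₂|²` are (twice) their moments for the standard form.  Everything follows from the way
the deformation `t dχ(x) ∧ dθ` affects these two functions.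

*Symplectic.*  The form `ω_t` is closed because `dθ` is, and it is nondegenerate because
`ω_t(a, i a) > 0` for every nonzero tangent vector `a` (`omega_nondegenerate`).  The mixed term
`dx ∧ dθ` is controlled by the other two, although `dθ` is unbounded where `u₁` is small:
the tangency condition allows one to express `dθ` through the larger of the coordinates `u₁`, `v₁`,
up to a multiple of the base component (`exists_norm_le_of_mem_tangent`).

*Not exact.*  The first circle factor collapses over both `-1` and `1`, and so sweeps out a
2-sphere over the segment `[-1, 1]`.  The standard form vanishes on it, and `t dχ ∧ dθ` has integral
`-2 π t` in polar coordinates, which Green's theorem rules out for an exact form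
(`not_isExact_omega`).

*The cores.*  Along a horizontal lift of a segment of the real axis, `|u₁|² - |v₁|² + 2 t χ(x)` and
`|u₂|² - |v₂|²` are constant, since horizontal vectors are orthogonal to the generators of the two
rotations.  The critical points at the ends fix the two constants, so the lifts which join critical
points lie in the set `momentSphere t ε`, where `ε = ±1` is the end of the segment other than `0`.
Conversely, through each point of this set there is a radial horizontal lift (`matchingCycle_eq`).
The map `sphereModel t ε` on `ℂ²` restricts to a Lagrangian embedding of the unit sphere with image
`momentSphere t ε`; writing `x = |q|²`, it has `z = ε x`, `u₂ = q`, and `u₁`, `v₁` proportional to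
`p`, `p̄` with factors determined by `u₁ v₁ = z² - 1` and by the prescribed moment.  The moment is
divisible by `1 - x = |p|²`, because `χ` is constant near `ε`, and this makes the factors smooth.

*Disjointness.*  The cores can only meet over `z = 0`, where `|u₁|² - |v₁|²` is `0` on the left
one and `2 t` on the right one; in the coordinates of the critical cylinder these are the circles
`r = 0` and `r = t`.
-/

namespace InexactPlumbing

open Set Filter Topology MeasureTheory

/-! ### The cutoff function -/

lemma contDiff_cutoff : ContDiff ℝ ∞ cutoff :=
  Real.smoothTransition.contDiff.comp (by fun_prop)

lemma hasDerivAt_cutoff (x : ℝ) : HasDerivAt cutoff (deriv cutoff x) x :=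
  (contDiff_cutoff.differentiable (by simp) x).hasDerivAt

lemma contDiff_deriv_cutoff : ContDiff ℝ ∞ (deriv cutoff) :=
  (contDiff_infty_iff_deriv.1 contDiff_cutoff).2

lemma cutoff_of_le {x : ℝ} (h : x ≤ 1 / 4) : cutoff x = 0 :=
  Real.smoothTransition.zero_of_nonpos (by linarith)

lemma cutoff_of_ge {x : ℝ} (h : 3 / 4 ≤ x) : cutoff x = 1 :=
  Real.smoothTransition.one_of_one_le (by linarith)

lemma deriv_cutoff_of_lt {x : ℝ} (h : x < 1 / 4) : deriv cutoff x = 0 := by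
  have : cutoff =ᶠ[𝓝 x] fun _ => 0 := by
    filter_upwards [Iio_mem_nhds h] with y hy using cutoff_of_le (le_of_lt hy)
  rw [this.deriv_eq, deriv_const]

lemma deriv_cutoff_of_gt {x : ℝ} (h : 3 / 4 < x) : deriv cutoff x = 0 := by
  have : cutoff =ᶠ[𝓝 x] fun _ => 1 := by
    filter_upwards [Ioi_mem_nhds h] with y hy using cutoff_of_ge (le_of_lt hy)
  rw [this.deriv_eq, deriv_const]

/-! ### Explicit formulas for the form -/

lemma dTheta_apply (w a : Amb) :
    dTheta w a = 1 / 2 * ((w 0)⁻¹ * a 0 - (w 1)⁻¹ * a 1).im := by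
  simp [dTheta]

lemma wedge_apply (α β : Amb →L[ℝ] ℝ) (v : Fin 2 → Amb) :
    wedge α β v = α (v 0) * β (v 1) - α (v 1) * β (v 0) := rfl

lemma omegaStd_apply (a b : Amb) :
    omegaStd ![a, b] = ∑ j, ((a j).re * (b j).im - (b j).re * (a j).im) := by
  rw [omegaStd, ContinuousAlternatingMap.sum_apply]
  rfl

lemma omega_apply (t : ℝ) (w a b : Amb) :
    omega t w ![a, b] = ∑ j, ((a j).re * (b j).im - (b j).re * (a j).im)
      + t * deriv cutoff (w 4).re * ((a 4).re * dTheta w b - (b 4).re * dTheta w a)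
      + 8 * (t * deriv cutoff (w 4).re) ^ 2 * ((a 4).re * (b 4).im - (b 4).re * (a 4).im) := by
  rw [← omegaStd_apply]
  rfl

lemma mem_tangent {w a : Amb} : a ∈ tangent w ↔
    a 0 * w 1 + w 0 * a 1 = 2 * w 4 * a 4 ∧ a 2 * w 3 + w 2 * a 3 = a 4 := Iff.rfl

/-- On `W₀`, the coordinates `u₁` and `v₁` can vanish only over `z = ±1`. -/
lemma ne_zero_of_mem {w : Amb} (hw : w ∈ W₀) (h : w 4 ^ 2 ≠ 1) : w 0 ≠ 0 ∧ w 1 ≠ 0 := by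
  have h1 := hw.1
  constructor <;> intro h0 <;> apply h <;> rw [h0] at h1 <;> linear_combination -h1

lemma re_of_sq_eq_one {z : ℂ} (h : z ^ 2 = 1) : z.re < 1 / 4 ∨ 3 / 4 < z.re := by
  rcases sq_eq_sq_iff_eq_or_eq_neg.1 (h.trans (one_pow 2).symm) with h | h <;> simp [h] <;> norm_num

/-- The critical points of `z` are the points where `u₁ = v₁ = 0` or `u₂ = v₂ = 0`. -/
lemma mem_criticalSet {w : Amb} (hw : w ∈ W₀) :
    w ∈ criticalSet ↔ (w 0 = 0 ∧ w 1 = 0) ∨ (w 2 = 0 ∧ w 3 = 0) := by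
  constructor
  · rintro ⟨-, h⟩
    by_contra! hc
    obtain ⟨h1, h2⟩ := hc
    have e1 : ∃ a b : ℂ, a * w 1 + w 0 * b = 2 * w 4 := by
      by_cases h0 : w 0 = 0
      · exact ⟨2 * w 4 / w 1, 0, by field_simp [h1 h0]; simp⟩
      · exact ⟨0, 2 * w 4 / w 0, by field_simp; simp⟩
    have e2 : ∃ a b : ℂ, a * w 3 + w 2 * b = 1 := by
      by_cases h0 : w 2 = 0
      · exact ⟨1 / w 3, 0, by field_simp [h2 h0]; simp⟩
      · exact ⟨0, 1 / w 2, by field_simp; simp⟩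
    obtain ⟨a, b, hab⟩ := e1
    obtain ⟨c, d, hcd⟩ := e2
    -- a tangent vector projecting to `1` in the base
    have := h ![a, b, c, d, 1] (mem_tangent.2 ⟨by simpa using hab, by simpa using hcd⟩)
    simp at this
  · rintro h
    refine ⟨hw, fun ξ hξ => ?_⟩
    obtain ⟨h1, h2⟩ := mem_tangent.1 hξ
    rcases h with ⟨h, h'⟩ | ⟨h, h'⟩
    · have := hw.1
      rw [h, h'] at h1 this
      have h4 : w 4 ≠ 0 := by rintro h4; rw [h4] at this; norm_num at this
      simpa [h4] using h1.symm
    · simpa [h, h'] using h2.symm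

/-! ### Smoothness, closedness and nondegeneracy -/

/-- `wedge α` as a linear map in the second covector. -/
noncomputable def wedgeRight (α : Amb →L[ℝ] ℝ) : (Amb →L[ℝ] ℝ) →ₗ[ℝ] Amb [⋀^Fin 2]→L[ℝ] ℝ where
  toFun := wedge α
  map_add' β γ := by ext v; simp [wedge_apply]; ring
  map_smul' c β := by ext v; simp [wedge_apply]; ring

lemma contDiffAt_dTheta {w : Amb} (h0 : w 0 ≠ 0) (h1 : w 1 ≠ 0) : ContDiffAt ℝ ∞ dTheta w := by
  have e0 : ContDiffAt ℝ ∞ (fun w : Amb => (w 0)⁻¹) w := by fun_prop (disch := assumption)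
  have e1 : ContDiffAt ℝ ∞ (fun w : Amb => (w 1)⁻¹) w := by fun_prop (disch := assumption)
  have e : ContDiffAt ℝ ∞ (fun w : Amb => (w 0)⁻¹ • (ContinuousLinearMap.proj 0 : Amb →L[ℝ] ℂ)
      - (w 1)⁻¹ • (ContinuousLinearMap.proj 1 : Amb →L[ℝ] ℂ)) w :=
    (e0.smul contDiffAt_const).sub (e1.smul contDiffAt_const)
  have e' : ContDiffAt ℝ ∞ (fun w : Amb => Complex.imCLM ∘L
      ((w 0)⁻¹ • (ContinuousLinearMap.proj 0 : Amb →L[ℝ] ℂ)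
      - (w 1)⁻¹ • (ContinuousLinearMap.proj 1 : Amb →L[ℝ] ℂ))) w := contDiffAt_const.clm_comp e
  exact e'.const_smul (1 / 2 : ℝ)

/-- Near the fibres over `±1`, where `dθ` is undefined, the form is the standard one. -/
lemma omega_eventuallyEq (t : ℝ) {w : Amb} (h : w 4 ^ 2 = 1) :
    omega t =ᶠ[𝓝 w] fun _ => omegaStd := by
  have hre : ContinuousAt (fun w : Amb => (w 4).re) w :=
    (Complex.continuous_re.comp (continuous_apply (4 : Fin 5))).continuousAt
  have : ∀ᶠ w' in 𝓝 w, deriv cutoff (w' 4).re = 0 := by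
    rcases re_of_sq_eq_one h with h | h
    · filter_upwards [hre.eventually (Iio_mem_nhds h)] with w' hw' using deriv_cutoff_of_lt hw'
    · filter_upwards [hre.eventually (Ioi_mem_nhds h)] with w' hw' using deriv_cutoff_of_gt hw'
  filter_upwards [this] with w' hw'
  simp [omega, hw']

lemma contDiffAt_omega (t : ℝ) {w : Amb} (hw : w ∈ W₀) : ContDiffAt ℝ ∞ (omega t) w := by
  by_cases h : w 4 ^ 2 = 1
  · exact contDiffAt_const.congr_of_eventuallyEq (omega_eventuallyEq t h)
  · obtain ⟨h0, h1⟩ := ne_zero_of_mem hw h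
    have hc : ContDiffAt ℝ ∞ (fun w : Amb => t * deriv cutoff (w 4).re) w := by
      refine contDiffAt_const.mul (contDiff_deriv_cutoff.contDiffAt.comp w ?_)
      exact (Complex.reCLM.contDiff.comp (contDiff_apply ℝ ℂ (4 : Fin 5))).contDiffAt
    have hL : ContDiff ℝ ∞ (wedgeRight (reC 4)) :=
      (LinearMap.toContinuousLinearMap (wedgeRight (reC 4))).contDiff
    exact (contDiffAt_const.add (hc.smul (hL.contDiffAt.comp w (contDiffAt_dTheta h0 h1)))).add
      ((contDiffAt_const.mul (hc.pow 2)).smul contDiffAt_const)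

/-- The derivative of `ω_t(b, c)` in the direction `a`, for constant vector fields `b` and `c`.
Where `χ'` is not differentiated, the derivative of `dθ(c)` in the direction `a` appears; it is
symmetric in `a` and `c`, which is the closedness of `dθ`. -/
lemma hasDerivAt_omega (t : ℝ) {w : Amb} (h0 : w 0 ≠ 0) (h1 : w 1 ≠ 0) (a b c : Amb) :
    HasDerivAt (fun s : ℝ => omega t (w + s • a) ![b, c])
      (t * (deriv (deriv cutoff) (w 4).re * (a 4).re) *
          ((b 4).re * dTheta w c - (c 4).re * dTheta w b)
        + t * deriv cutoff (w 4).re *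
          ((b 4).re * (1 / 2 * (-((w 0) ^ 2)⁻¹ * a 0 * c 0 + ((w 1) ^ 2)⁻¹ * a 1 * c 1).im)
            - (c 4).re * (1 / 2 * (-((w 0) ^ 2)⁻¹ * a 0 * b 0 + ((w 1) ^ 2)⁻¹ * a 1 * b 1).im))
        + 16 * (t * deriv cutoff (w 4).re) * (t * (deriv (deriv cutoff) (w 4).re * (a 4).re)) *
          ((b 4).re * (c 4).im - (c 4).re * (b 4).im)) 0 := by
  have hl : ∀ j, HasDerivAt (fun s : ℝ => (w + s • a) j) (a j) 0 := fun j => by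
    have := ((hasDerivAt_id (0 : ℝ)).smul_const (a j)).const_add (w j)
    simpa using this
  have hre : HasDerivAt (fun s : ℝ => ((w + s • a) 4).re) (a 4).re 0 :=
    Complex.reCLM.hasFDerivAt.comp_hasDerivAt 0 (hl 4)
  have hχ : HasDerivAt (fun s : ℝ => t * deriv cutoff ((w + s • a) 4).re)
      (t * (deriv (deriv cutoff) (w 4).re * (a 4).re)) 0 := by
    have h2 : HasDerivAt (deriv cutoff) (deriv (deriv cutoff) (w 4).re)
        (((w + (0 : ℝ) • a) 4).re) := by
      simpa using (contDiff_deriv_cutoff.differentiable (by simp) (w 4).re).hasDerivAt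
    exact (h2.comp 0 hre).const_mul t
  have hθ : ∀ c : Amb, HasDerivAt (fun s : ℝ => dTheta (w + s • a) c)
      (1 / 2 * (-((w 0) ^ 2)⁻¹ * a 0 * c 0 + ((w 1) ^ 2)⁻¹ * a 1 * c 1).im) 0 := fun c => by
    have i0 := ((hl 0).inv (by simpa using h0)).mul_const (c 0)
    have i1 := ((hl 1).inv (by simpa using h1)).mul_const (c 1)
    have := (Complex.imCLM.hasFDerivAt.comp_hasDerivAt 0 (i0.sub i1)).const_mul (1 / 2 : ℝ)
    simp only [dTheta_apply]
    refine this.congr_deriv ?_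
    simp only [zero_smul, add_zero, Complex.imCLM_apply]
    congr 2
    ring
  have key := ((((hχ.mul (((hθ c).const_mul (b 4).re).sub ((hθ b).const_mul (c 4).re))).const_add
    (∑ j, ((b j).re * (c j).im - (c j).re * (b j).im))).add
    (((hχ.pow 2).const_mul 8).mul_const ((b 4).re * (c 4).im - (c 4).re * (b 4).im))))
  simp only [omega_apply]
  refine key.congr_deriv ?_
  simp only [zero_smul, add_zero, Pi.sub_apply, Nat.cast_ofNat, Nat.reduceSub, pow_one]
  ring

lemma fderiv_omega_apply (t : ℝ) {w : Amb} (hw : w ∈ W₀) (a b c : Amb) :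
    fderiv ℝ (omega t) w a ![b, c] = deriv (fun s : ℝ => omega t (w + s • a) ![b, c]) 0 := by
  have hd := (contDiffAt_omega t hw).differentiableAt (by simp)
  have hl : HasDerivAt (fun s : ℝ => w + s • a) a 0 := by
    simpa using ((hasDerivAt_id (0 : ℝ)).smul_const a).const_add w
  have h1 : HasDerivAt (fun s : ℝ => omega t (w + s • a)) (fderiv ℝ (omega t) w a) 0 :=
    HasFDerivAt.comp_hasDerivAt (l := omega t) 0 (by simpa using hd.hasFDerivAt) hl
  have h2 := ((ContinuousAlternatingMap.apply ℝ Amb ℝ ![b, c]).hasFDerivAt).comp_hasDerivAt 0 h1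
  exact h2.deriv.symm

lemma removeNth_three (a b c : Amb) : Fin.removeNth 0 ![a, b, c] = ![b, c] ∧
    Fin.removeNth 1 ![a, b, c] = ![a, c] ∧ Fin.removeNth 2 ![a, b, c] = ![a, b] := by
  refine ⟨?_, ?_, ?_⟩ <;> ext i <;> fin_cases i <;> rfl

lemma extDeriv_omega (t : ℝ) {w : Amb} (hw : w ∈ W₀) (a b c : Amb) :
    extDeriv (omega t) w ![a, b, c] = 0 := by
  obtain ⟨r0, r1, r2⟩ := removeNth_three a b c
  rw [extDeriv, ContinuousAlternatingMap.alternatizeUncurryFin_apply, Fin.sum_univ_three,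
    r0, r1, r2]
  by_cases h : w 4 ^ 2 = 1
  · simp [(omega_eventuallyEq t h).fderiv_eq]
  · obtain ⟨h0, h1⟩ := ne_zero_of_mem hw h
    simp only [Matrix.cons_val_zero, Matrix.cons_val_one, Matrix.cons_val,
      fderiv_omega_apply t hw, (hasDerivAt_omega t h0 h1 _ _ _).deriv]
    simp
    ring

/-- Over the strip where the cutoff varies, `z² - 1` is bounded away from zero and dominates `z`. -/
lemma norm_sq_sub_one_bounds {z : ℂ} (h1 : 1 / 4 ≤ z.re) (h2 : z.re ≤ 3 / 4) :
    5 / 16 ≤ ‖z ^ 2 - 1‖ ∧ ‖z‖ ≤ 4 * ‖z ^ 2 - 1‖ := by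
  have e : ‖z ^ 2 - 1‖ = ‖z - 1‖ * ‖z + 1‖ := by rw [← norm_mul]; ring_nf
  have hm : 1 / 4 ≤ ‖z - 1‖ := by
    have := Complex.abs_re_le_norm (z - 1)
    have h3 := neg_le_abs (z - 1).re
    simp at this h3
    linarith
  have hp : 5 / 4 ≤ ‖z + 1‖ := by
    have := Complex.re_le_norm (z + 1)
    simp at this
    linarith
  have hz : ‖z‖ ≤ ‖z + 1‖ := by
    rw [Complex.norm_eq_sqrt_sq_add_sq, Complex.norm_eq_sqrt_sq_add_sq]
    apply Real.sqrt_le_sqrt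
    simp
    nlinarith
  rw [e]
  constructor <;> nlinarith [norm_nonneg (z - 1), norm_nonneg (z + 1)]

/-- The complex number of which `dθ` is half the imaginary part on a tangent vector, and half the
real part on its rotation by `i`, is controlled, over the strip, by the
base component of the vector and by the component along the larger of `u₁`, `v₁`. -/
lemma exists_norm_le_of_mem_tangent {w a : Amb} (hw : w ∈ W₀) (ha : a ∈ tangent w)
    (h1 : 1 / 4 ≤ (w 4).re) (h2 : (w 4).re ≤ 3 / 4) :
    ∃ k : ℝ, 0 ≤ k ∧ k ^ 2 ≤ 16 / 5 ∧ ∃ m : ℝ, 0 ≤ m ∧ m ^ 2 ≤ ‖a 0‖ ^ 2 + ‖a 1‖ ^ 2 ∧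
      ‖(w 0)⁻¹ * a 0 - (w 1)⁻¹ * a 1‖ ≤ 8 * ‖a 4‖ + 2 * (k * m) := by
  obtain ⟨b1, b2⟩ := norm_sq_sub_one_bounds h1 h2
  have hne : w 4 ^ 2 - 1 ≠ 0 := norm_pos_iff.1 (by linarith)
  obtain ⟨n0, n1⟩ := ne_zero_of_mem hw (sub_ne_zero.1 hne)
  obtain ⟨ht, -⟩ := mem_tangent.1 ha
  have hq : (w 0)⁻¹ * a 0 + (w 1)⁻¹ * a 1 = 2 * w 4 * a 4 / (w 4 ^ 2 - 1) := by
    rw [← ht, ← hw.1]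
    field_simp
  have hqn : ‖2 * w 4 * a 4 / (w 4 ^ 2 - 1)‖ ≤ 8 * ‖a 4‖ := by
    rw [norm_div, norm_mul, norm_mul, div_le_iff₀ (by linarith)]
    simp only [Complex.norm_ofNat]
    nlinarith [norm_nonneg (a 4)]
  have hprod : ‖w 0‖ * ‖w 1‖ = ‖w 4 ^ 2 - 1‖ := by rw [← norm_mul, hw.1]
  have p0 := norm_pos_iff.2 n0
  have p1 := norm_pos_iff.2 n1
  -- `a₀ / u₁ + a₁ / v₁` is known, so the quotient by the smaller coordinate can be eliminated
  rcases le_total ‖w 0‖ ‖w 1‖ with hle | hle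
  · refine ⟨‖w 1‖⁻¹, by positivity, ?_, ‖a 1‖, by positivity, by nlinarith [sq_nonneg ‖a 0‖], ?_⟩
    · rw [inv_pow, inv_le_comm₀ (by positivity) (by norm_num)]
      norm_num
      nlinarith
    · have : (w 0)⁻¹ * a 0 - (w 1)⁻¹ * a 1
          = 2 * w 4 * a 4 / (w 4 ^ 2 - 1) - 2 * ((w 1)⁻¹ * a 1) := by rw [← hq]; ring
      rw [this]
      refine (norm_sub_le _ _).trans (add_le_add hqn ?_)
      simp
  · refine ⟨‖w 0‖⁻¹, by positivity, ?_, ‖a 0‖, by positivity, by nlinarith [sq_nonneg ‖a 1‖], ?_⟩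
    · rw [inv_pow, inv_le_comm₀ (by positivity) (by norm_num)]
      norm_num
      nlinarith
    · have : (w 0)⁻¹ * a 0 - (w 1)⁻¹ * a 1
          = 2 * ((w 0)⁻¹ * a 0) - 2 * w 4 * a 4 / (w 4 ^ 2 - 1) := by rw [← hq]; ring
      rw [this]
      refine (norm_sub_le _ _).trans ?_
      rw [add_comm]
      refine add_le_add hqn ?_
      simp

lemma I_smul_mem_tangent {w a : Amb} (ha : a ∈ tangent w) : Complex.I • a ∈ tangent w := by
  obtain ⟨h1, h2⟩ := mem_tangent.1 ha
  refine mem_tangent.2 ⟨?_, ?_⟩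
  · simp only [Pi.smul_apply, smul_eq_mul]; linear_combination Complex.I * h1
  · simp only [Pi.smul_apply, smul_eq_mul]; linear_combination Complex.I * h2

lemma omega_I_smul (t : ℝ) (w a : Amb) :
    omega t w ![a, Complex.I • a] = ∑ j, ‖a j‖ ^ 2
      + t * deriv cutoff (w 4).re / 2 *
        ((a 4).re * ((w 0)⁻¹ * a 0 - (w 1)⁻¹ * a 1).re
          + (a 4).im * ((w 0)⁻¹ * a 0 - (w 1)⁻¹ * a 1).im)
      + 8 * (t * deriv cutoff (w 4).re) ^ 2 * ‖a 4‖ ^ 2 := by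
  have e : ∀ j, ‖a j‖ ^ 2 = (a j).re * (a j).re + (a j).im * (a j).im := fun j => by
    rw [← Complex.normSq_eq_norm_sq, Complex.normSq_apply]
  have hθ : dTheta w (Complex.I • a) = 1 / 2 * ((w 0)⁻¹ * a 0 - (w 1)⁻¹ * a 1).re := by
    rw [dTheta_apply]
    simp only [Pi.smul_apply, smul_eq_mul]
    rw [show (w 0)⁻¹ * (Complex.I * a 0) - (w 1)⁻¹ * (Complex.I * a 1)
      = Complex.I * ((w 0)⁻¹ * a 0 - (w 1)⁻¹ * a 1) by ring, Complex.I_mul_im]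
  rw [omega_apply, hθ, dTheta_apply]
  simp only [e, Pi.smul_apply, smul_eq_mul, Complex.I_mul_re, Complex.I_mul_im]
  simp only [Fin.sum_univ_five]
  ring

/-- On the tangent spaces of `W₀`, the number `ω_t(a, i a)` vanishes only for `a = 0`. -/
lemma omega_nondegenerate (t : ℝ) {w a : Amb} (hw : w ∈ W₀) (ha : a ∈ tangent w)
    (h : omega t w ![a, Complex.I • a] = 0) : a = 0 := by
  rw [omega_I_smul] at h
  have hpos : ∀ j ∈ Finset.univ, 0 ≤ ‖a j‖ ^ 2 := fun j _ => sq_nonneg _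
  suffices h4 : t * deriv cutoff (w 4).re = 0 ∨ a 4 = 0 by
    have hz : ∑ j, ‖a j‖ ^ 2 = 0 := by rcases h4 with h4 | h4 <;> simpa [h4] using h
    ext j
    simpa using (Finset.sum_eq_zero_iff_of_nonneg hpos).1 hz j (Finset.mem_univ j)
  by_contra! hc
  obtain ⟨hs, h4⟩ := hc
  have l1 : 1 / 4 ≤ (w 4).re := not_lt.1 fun hl => hs (by rw [deriv_cutoff_of_lt hl, mul_zero])
  have l2 : (w 4).re ≤ 3 / 4 := not_lt.1 fun hl => hs (by rw [deriv_cutoff_of_gt hl, mul_zero])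
  obtain ⟨k, hk0, hk, m, hm0, hm, hP⟩ := exists_norm_le_of_mem_tangent hw ha l1 l2
  set s := t * deriv cutoff (w 4).re
  set P := (w 0)⁻¹ * a 0 - (w 1)⁻¹ * a 1
  have hn : 0 < ‖a 4‖ := norm_pos_iff.2 h4
  have hCS : |(a 4).re * P.re + (a 4).im * P.im| ≤ ‖a 4‖ * ‖P‖ := by
    have e : (a 4).re * P.re + (a 4).im * P.im = ((starRingEnd ℂ) (a 4) * P).re := by simp
    rw [e, ← Complex.norm_conj (a 4), ← norm_mul]
    exact Complex.abs_re_le_norm _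
  have hb : -(|s| / 2 * (‖a 4‖ * (8 * ‖a 4‖ + 2 * (k * m)))) ≤
      s / 2 * ((a 4).re * P.re + (a 4).im * P.im) := by
    refine neg_le_of_abs_le ?_
    rw [abs_mul, abs_div, abs_two]
    gcongr
    exact hCS.trans (by gcongr)
  have hsum : ∑ j, ‖a j‖ ^ 2 ≥ m ^ 2 + ‖a 4‖ ^ 2 := by
    rw [Fin.sum_univ_five]
    nlinarith [sq_nonneg ‖a 2‖, sq_nonneg ‖a 3‖]
  have hss : s ^ 2 = |s| ^ 2 := (sq_abs s).symm
  rw [hss] at h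
  -- completing the square in `m` leaves `‖a₄‖² (1 - 4 |s| + (8 - 4 / 5) s²)`, which is positive
  have hk2 : (|s| * ‖a 4‖ * k) ^ 2 ≤ |s| ^ 2 * ‖a 4‖ ^ 2 * (16 / 5) := by
    rw [mul_pow, mul_pow]; gcongr
  have e1 : 0 ≤ (2 * m - |s| * ‖a 4‖ * k) ^ 2 := sq_nonneg _
  have e2 : 0 ≤ ‖a 4‖ ^ 2 * (|s| * 3 - 1) ^ 2 := by positivity
  have e3 : 0 ≤ ‖a 4‖ ^ 2 * (|s| * 2 - 1) ^ 2 := by positivity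
  have e4 : 0 < ‖a 4‖ ^ 2 := by positivity
  have e5 : 0 ≤ |s| ^ 2 * ‖a 4‖ ^ 2 := by positivity
  nlinarith

lemma isSymplectic_omega (t : ℝ) : IsSymplectic (omega t) where
  smooth _ hw := contDiffAt_omega t hw
  closed _ hw a _ b _ c _ := extDeriv_omega t hw a b c
  nondegenerate _ hw _ ha h := omega_nondegenerate t hw ha (h _ (I_smul_mem_tangent ha))

/-! ### Non-exactness -/

/-- The velocity of a curve in `W₀` is tangent to `W₀`. -/
lemma mem_tangent_of_hasDerivAt {c : ℝ → Amb} {ξ : Amb} {s : ℝ} (h : HasDerivAt c ξ s)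
    (hc : ∀ᶠ s' in 𝓝 s, c s' ∈ W₀) : ξ ∈ tangent (c s) := by
  have hj : ∀ j, HasDerivAt (fun s => c s j) (ξ j) s := hasDerivAt_pi.1 h
  have e1 : (fun s => c s 0 * c s 1) =ᶠ[𝓝 s] fun s => c s 4 ^ 2 - 1 := hc.mono fun _ h => h.1
  have e2 : (fun s => c s 2 * c s 3) =ᶠ[𝓝 s] fun s => c s 4 := hc.mono fun _ h => h.2
  have d1 := (((hj 0).mul (hj 1)).congr_of_eventuallyEq e1.symm).unique
    (((hj 4).pow 2).sub_const 1)
  have d2 := (((hj 2).mul (hj 3)).congr_of_eventuallyEq e2.symm).unique (hj 4)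
  exact mem_tangent.2 ⟨d1.trans (by norm_num), d2⟩

/-- Green's theorem for a differentiable 1-form on a rectangle. -/
lemma integral_extDeriv_rectangle (β : ℝ × ℝ → (ℝ × ℝ) [⋀^Fin 1]→L[ℝ] ℝ)
    (hβ : Differentiable ℝ β) (hc : Continuous fun x => extDeriv β x ![(1, 0), (0, 1)])
    (a₁ b₁ a₂ b₂ : ℝ) :
    ∫ x in a₁..b₁, ∫ y in a₂..b₂, extDeriv β (x, y) ![(1, 0), (0, 1)] =
      (((∫ x in a₁..b₁, -β (x, b₂) ![(1, 0)]) - ∫ x in a₁..b₁, -β (x, a₂) ![(1, 0)])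
        + ∫ y in a₂..b₂, β (b₁, y) ![(0, 1)]) - ∫ y in a₂..b₂, β (a₁, y) ![(0, 1)] := by
  have hd : ∀ (x v : ℝ × ℝ), HasFDerivAt (fun x => β x ![v])
      (fderiv ℝ (fun x => β x ![v]) x) x := fun x v =>
    ((hβ x).continuousAlternatingMap_apply_const _).hasFDerivAt
  have r0 : Fin.removeNth 0 ![((1 : ℝ), (0 : ℝ)), (0, 1)] = ![(0, 1)] := by
    ext i <;> fin_cases i <;> rfl
  have r1 : Fin.removeNth 1 ![((1 : ℝ), (0 : ℝ)), (0, 1)] = ![(1, 0)] := by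
    ext i <;> fin_cases i <;> rfl
  have he : ∀ x, extDeriv β x ![(1, 0), (0, 1)] =
      fderiv ℝ (fun x => β x ![(0, 1)]) x (1, 0)
        + (-fderiv ℝ (fun x => β x ![(1, 0)]) x) (0, 1) := fun x => by
    rw [extDeriv_apply (hβ x), Fin.sum_univ_two, r0, r1]
    simp
  simp only [he] at hc ⊢
  refine integral2_divergence_prod_of_hasFDerivAt (fun x => β x ![(0, 1)])
    (fun x => -β x ![(1, 0)]) (fderiv ℝ fun x => β x ![(0, 1)])
    (fun x => -fderiv ℝ (fun x => β x ![(1, 0)]) x) a₁ a₂ b₁ b₂ ?_ ?_ ?_ ?_ ?_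
  · exact fun x _ => (hd x _).continuousAt.continuousWithinAt
  · exact fun x _ => (hd x _).neg.continuousAt.continuousWithinAt
  · exact fun x _ => hd x _
  · exact fun x _ => (hd x _).neg
  · exact hc.continuousOn.integrableOn_compact (isCompact_uIcc.prod isCompact_uIcc)

/-- Polar coordinates `(φ, θ)` on the 2-sphere `v₁ = -ū₁`, `v₂ = 1`, `z ∈ [-1, 1]`, which is swept
out by the first circle factor of the fibre over the segment `[-1, 1]`. -/
noncomputable def polarSphere (p : ℝ × ℝ) : Amb :=
  ![Real.sin p.1 * Complex.exp (p.2 * Complex.I),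
    -(Real.sin p.1 * Complex.exp (-(p.2 * Complex.I))), Real.cos p.1, 1, Real.cos p.1]

lemma polarSphere_mem (p : ℝ × ℝ) : polarSphere p ∈ W₀ := by
  refine ⟨?_, ?_⟩
  · have h : Complex.exp (p.2 * Complex.I) * Complex.exp (-(p.2 * Complex.I)) = 1 := by
      rw [← Complex.exp_add]; simp
    have h2 := Complex.sin_sq_add_cos_sq p.1
    simp [polarSphere]
    linear_combination -Complex.sin p.1 ^ 2 * h - h2
  · simp [polarSphere]

lemma contDiff_polarSphere : ContDiff ℝ ∞ polarSphere := by
  have h1 : ContDiff ℝ ∞ fun p : ℝ × ℝ => (Real.sin p.1 : ℂ) :=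
    Complex.ofRealCLM.contDiff.comp (Real.contDiff_sin.comp contDiff_fst)
  have h2 : ContDiff ℝ ∞ fun p : ℝ × ℝ => (Real.cos p.1 : ℂ) :=
    Complex.ofRealCLM.contDiff.comp (Real.contDiff_cos.comp contDiff_fst)
  have h3 : ContDiff ℝ ∞ fun p : ℝ × ℝ => (p.2 * Complex.I : ℂ) :=
    (Complex.ofRealCLM.contDiff.comp contDiff_snd).mul contDiff_const
  rw [contDiff_pi]
  intro i
  fin_cases i
  · exact h1.mul h3.cexp
  · exact (h1.mul h3.neg.cexp).neg
  · exact h2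
  · exact contDiff_const
  · exact h2

lemma fderiv_polarSphere_fst (p : ℝ × ℝ) : fderiv ℝ polarSphere p (1, 0) =
    ![Real.cos p.1 * Complex.exp (p.2 * Complex.I),
      -(Real.cos p.1 * Complex.exp (-(p.2 * Complex.I))), -Real.sin p.1, 0, -Real.sin p.1] := by
  have hl : HasDerivAt (fun φ : ℝ => (φ, p.2)) ((1 : ℝ), (0 : ℝ)) p.1 :=
    (hasDerivAt_id p.1).prodMk (hasDerivAt_const _ _)
  have h := ((contDiff_polarSphere.differentiable (by simp) p).hasFDerivAt).comp_hasDerivAt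
    (f := fun φ : ℝ => (φ, p.2)) p.1 hl
  refine h.unique (hasDerivAt_pi.2 fun i => ?_)
  have hs : HasDerivAt (fun φ : ℝ => (Real.sin φ : ℂ)) (Real.cos p.1) p.1 :=
    (Real.hasDerivAt_sin p.1).ofReal_comp
  have hc : HasDerivAt (fun φ : ℝ => (Real.cos φ : ℂ)) (-Real.sin p.1) p.1 := by
    simpa using (Real.hasDerivAt_cos p.1).ofReal_comp
  fin_cases i
  · exact hs.mul_const (Complex.exp (p.2 * Complex.I))
  · exact (hs.mul_const (Complex.exp (-(p.2 * Complex.I)))).neg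
  · exact hc
  · exact hasDerivAt_const _ _
  · exact hc

lemma fderiv_polarSphere_snd (p : ℝ × ℝ) : fderiv ℝ polarSphere p (0, 1) =
    ![Complex.I * (Real.sin p.1 * Complex.exp (p.2 * Complex.I)),
      Complex.I * (Real.sin p.1 * Complex.exp (-(p.2 * Complex.I))), 0, 0, 0] := by
  have hl : HasDerivAt (fun θ : ℝ => (p.1, θ)) ((0 : ℝ), (1 : ℝ)) p.2 :=
    (hasDerivAt_const _ _).prodMk (hasDerivAt_id p.2)
  have h := ((contDiff_polarSphere.differentiable (by simp) p).hasFDerivAt).comp_hasDerivAt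
    (f := fun θ : ℝ => (p.1, θ)) p.2 hl
  refine h.unique (hasDerivAt_pi.2 fun i => ?_)
  have hI : HasDerivAt (fun θ : ℝ => (θ * Complex.I : ℂ)) Complex.I p.2 := by
    simpa using (hasDerivAt_id p.2).ofReal_comp.mul_const Complex.I
  fin_cases i
  · refine (hI.cexp.const_mul (Real.sin p.1 : ℂ)).congr_deriv ?_
    change _ = Complex.I * (Real.sin p.1 * Complex.exp (p.2 * Complex.I))
    ring
  · refine (hI.neg.cexp.const_mul (Real.sin p.1 : ℂ)).neg.congr_deriv ?_
    change _ = Complex.I * (Real.sin p.1 * Complex.exp (-(p.2 * Complex.I)))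
    simp only [Pi.neg_apply]
    ring
  · exact hasDerivAt_const p.2 (Real.cos p.1 : ℂ)
  · exact hasDerivAt_const _ _
  · exact hasDerivAt_const p.2 (Real.cos p.1 : ℂ)

/-- The pullback of `ω_t` to the sphere is `t χ'(z) dz ∧ dθ`. -/
lemma omega_polarSphere (t : ℝ) (p : ℝ × ℝ) :
    omega t (polarSphere p) ![fderiv ℝ polarSphere p (1, 0), fderiv ℝ polarSphere p (0, 1)] =
      -(t * (deriv cutoff (Real.cos p.1) * Real.sin p.1)) := by
  have hθ : (Real.sin p.1) * dTheta (polarSphere p) (fderiv ℝ polarSphere p (0, 1)) =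
      Real.sin p.1 := by
    by_cases h0 : Real.sin p.1 = 0
    · simp [h0]
    have h0' : (Real.sin p.1 : ℂ) ≠ 0 := by exact_mod_cast h0
    have e : ((polarSphere p) 0)⁻¹ * fderiv ℝ polarSphere p (0, 1) 0
        - ((polarSphere p) 1)⁻¹ * fderiv ℝ polarSphere p (0, 1) 1 = 2 * Complex.I := by
      rw [fderiv_polarSphere_snd]
      simp only [polarSphere, Matrix.cons_val_zero, Matrix.cons_val_one]
      field_simp [Complex.exp_ne_zero]
      ring
    rw [dTheta_apply, e]
    simp
  have h4 : (polarSphere p 4).re = Real.cos p.1 := by simp [polarSphere, -Complex.ofReal_cos]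
  rw [omega_apply, h4, fderiv_polarSphere_fst, Fin.sum_univ_five]
  generalize dTheta (polarSphere p) (fderiv ℝ polarSphere p (0, 1)) = A at hθ ⊢
  rw [fderiv_polarSphere_snd]
  have e1 : Complex.exp (p.2 * Complex.I) = Real.cos p.2 + Real.sin p.2 * Complex.I := by
    rw [Complex.exp_mul_I]; simp
  have e2 : Complex.exp (-(p.2 * Complex.I)) = Real.cos p.2 - Real.sin p.2 * Complex.I := by
    rw [← neg_mul, Complex.exp_mul_I]; simp; ring
  rw [e1, e2]
  simp [-Complex.ofReal_cos, -Complex.ofReal_sin]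

  linear_combination t * deriv cutoff (Real.cos p.1) * hθ

lemma not_isExact_omega {t : ℝ} (ht : t ≠ 0) : ¬ IsExact (omega t) := by
  rintro ⟨α, hα, hαω⟩
  set β : ℝ × ℝ → (ℝ × ℝ) [⋀^Fin 1]→L[ℝ] ℝ := fun p =>
    (α (polarSphere p)).compContinuousLinearMap (fderiv ℝ polarSphere p) with hβdef
  have hα' : ∀ p, DifferentiableAt ℝ α (polarSphere p) := fun p =>
    (hα _ (polarSphere_mem p)).differentiableAt (by simp)
  have hβ : Differentiable ℝ β := fun p =>
    ((hα' p).comp p (contDiff_polarSphere.differentiable (by simp) p)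
      ).continuousAlternatingMapCompContinuousLinearMap
      ((contDiff_polarSphere.fderiv_right (m := ∞) (by simp)).differentiable (by simp) p)
  have htan : ∀ p v, fderiv ℝ polarSphere p v ∈ tangent (polarSphere p) := fun p v => by
    have hl : HasDerivAt (fun s : ℝ => p + s • v) v 0 := by
      simpa using ((hasDerivAt_id (0 : ℝ)).smul_const v).const_add p
    have hd : HasFDerivAt polarSphere (fderiv ℝ polarSphere p) (p + (0 : ℝ) • v) := by
      simpa using (contDiff_polarSphere.differentiable (by simp) p).hasFDerivAt
    simpa using mem_tangent_of_hasDerivAt (hd.comp_hasDerivAt (0 : ℝ) hl)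
      (Eventually.of_forall fun s => polarSphere_mem (p + s • v))
  -- a primitive of `ω_t` would pull back to a primitive of `t χ'(z) dz ∧ dθ`
  have hext : ∀ p, extDeriv β p ![(1, 0), (0, 1)] =
      -(t * (deriv cutoff (Real.cos p.1) * Real.sin p.1)) := fun p => by
    rw [← omega_polarSphere, ← hαω _ (polarSphere_mem p) _ (htan p _) _ (htan p _), hβdef,
      extDeriv_pullback (hα' p) (contDiff_polarSphere.contDiffAt.of_le (m := 2) (by norm_cast))
        (by simp)]
    simp only [ContinuousAlternatingMap.compContinuousLinearMap_apply]
    congr 1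
    ext i j
    fin_cases i <;> rfl
  have key := integral_extDeriv_rectangle β hβ (by
    simp only [hext]
    have := contDiff_deriv_cutoff.continuous
    fun_prop) 0 Real.pi 0 (2 * Real.pi)
  -- the boundary terms of the rectangle cancel in `θ`, by periodicity, and vanish at the poles
  have hper : ∀ φ, β (φ, 2 * Real.pi) ![(1, 0)] = β (φ, 0) ![(1, 0)] := fun φ => by
    have h1 : polarSphere (φ, 2 * Real.pi) = polarSphere (φ, 0) := by
      simp [polarSphere, Complex.exp_neg]
    have h2 : fderiv ℝ polarSphere (φ, 2 * Real.pi) (1, 0)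
        = fderiv ℝ polarSphere (φ, 0) (1, 0) := by
      simp [fderiv_polarSphere_fst, Complex.exp_neg]
    have h3 : ∀ x, β x ![(1, 0)] = α (polarSphere x) ![fderiv ℝ polarSphere x (1, 0)] :=
      fun x => congrArg (α (polarSphere x)) (by ext i j; fin_cases i; rfl)
    rw [h3, h3, h1, h2]
  have hpole : ∀ φ θ, Real.sin φ = 0 → β (φ, θ) ![(0, 1)] = 0 := fun φ θ h => by
    have h1 : fderiv ℝ polarSphere (φ, θ) (0, 1) = 0 := by
      rw [fderiv_polarSphere_snd]
      ext i
      fin_cases i <;> simp [h, -Complex.ofReal_sin]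
    exact (α (polarSphere (φ, θ))).map_coord_zero 0 h1
  simp only [hext, hper, hpole _ _ Real.sin_pi, hpole _ _ Real.sin_zero] at key
  have hFTC : ∫ φ in (0 : ℝ)..Real.pi, -(t * (deriv cutoff (Real.cos φ) * Real.sin φ)) = -t := by
    have hd : ∀ φ ∈ uIcc 0 Real.pi, HasDerivAt (fun φ => t * cutoff (Real.cos φ))
        (-(t * (deriv cutoff (Real.cos φ) * Real.sin φ))) φ := fun φ _ =>
      (((hasDerivAt_cutoff _).comp φ (Real.hasDerivAt_cos φ)).const_mul t).congr_deriv (by ring)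
    have hc := contDiff_deriv_cutoff.continuous
    rw [intervalIntegral.integral_eq_sub_of_hasDerivAt hd
      (Continuous.intervalIntegrable (by fun_prop) _ _), Real.cos_pi, Real.cos_zero,
      cutoff_of_le (by norm_num), cutoff_of_ge (by norm_num)]
    ring
  simp only [intervalIntegral.integral_const, smul_eq_mul, intervalIntegral.integral_const_mul,
    sub_self, intervalIntegral.integral_zero, add_zero, sub_zero, hFTC] at key
  have := Real.pi_pos
  exact ht (by simpa [this.ne'] using key)

/-! ### The profile functions of the core spheres -/

/-- The function `n` with `(1 - x) n(x) = t (χ(ε) - χ(ε x))`, where the right-hand side is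
`(|u₁|² - |v₁|²) / 2` on the core over the segment from `0` to `ε = ±1`, and `x = ε z`.  The
function vanishes near `x = 1`, and the value `0` of the quotient at `x = 1` makes it smooth there. -/
noncomputable def momentQuotient (t ε x : ℝ) : ℝ := t * (cutoff ε - cutoff (ε * x)) / (1 - x)

/-- The ratio of `u₁` to `p` on the core, as a function of `x = |q|²`: together with `profileV`, it
solves `a b = 1 + x`, `a² - b² = 2 n(x)`. -/
noncomputable def profileU (t ε x : ℝ) : ℝ :=
  √(momentQuotient t ε x + √(momentQuotient t ε x ^ 2 + (1 + x) ^ 2))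

/-- The ratio of `-v₁` to `p̄` on the core, as a function of `x = |q|²`. -/
noncomputable def profileV (t ε x : ℝ) : ℝ :=
  √(-momentQuotient t ε x + √(momentQuotient t ε x ^ 2 + (1 + x) ^ 2))

variable {t ε : ℝ}

lemma cutoff_mul_eventuallyEq (hε : ε = 1 ∨ ε = -1) :
    ∀ᶠ x in 𝓝 (1 : ℝ), cutoff (ε * x) = cutoff ε := by
  have : Ioi (3 / 4 : ℝ) ∈ 𝓝 (1 : ℝ) := Ioi_mem_nhds (by norm_num)
  filter_upwards [this] with x hx
  have hx : (3 / 4 : ℝ) < x := hx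
  rcases hε with rfl | rfl
  · rw [cutoff_of_ge (by linarith), cutoff_of_ge (by norm_num)]
  · rw [cutoff_of_le (by linarith), cutoff_of_le (by norm_num)]

lemma one_sub_mul_momentQuotient (t ε x : ℝ) :
    (1 - x) * momentQuotient t ε x = t * (cutoff ε - cutoff (ε * x)) := by
  by_cases hx : 1 - x = 0
  · have : x = 1 := by linarith
    subst this
    simp
  · rw [momentQuotient]
    field_simp

lemma contDiff_momentQuotient (t : ℝ) (hε : ε = 1 ∨ ε = -1) :
    ContDiff ℝ ∞ (momentQuotient t ε) := by
  rw [contDiff_iff_contDiffAt]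
  intro x
  by_cases hx : x = 1
  · have : momentQuotient t ε =ᶠ[𝓝 x] fun _ => 0 := by
      rw [hx]
      filter_upwards [cutoff_mul_eventuallyEq hε] with y hy
      simp [momentQuotient, hy]
    exact contDiffAt_const.congr_of_eventuallyEq this
  · have h1 : ContDiff ℝ ∞ fun x => t * (cutoff ε - cutoff (ε * x)) :=
      contDiff_const.mul
        (contDiff_const.sub (contDiff_cutoff.comp (contDiff_const.mul contDiff_id)))
    exact h1.contDiffAt.div (contDiffAt_const.sub contDiffAt_id) (sub_ne_zero.2 (Ne.symm hx))

lemma abs_lt_sqrt_sq_add_sq (n : ℝ) {y : ℝ} (hy : 0 < y) : |n| < √(n ^ 2 + y ^ 2) := by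
  rw [← Real.sqrt_sq_eq_abs]
  exact Real.sqrt_lt_sqrt (sq_nonneg n) (by nlinarith)

lemma profileU_pos (t ε : ℝ) {x : ℝ} (hx : -1 < x) : 0 < profileU t ε x := by
  have := abs_lt.1 (abs_lt_sqrt_sq_add_sq (momentQuotient t ε x) (y := 1 + x) (by linarith))
  exact Real.sqrt_pos.2 (by linarith)

lemma profileV_pos (t ε : ℝ) {x : ℝ} (hx : -1 < x) : 0 < profileV t ε x := by
  have := abs_lt.1 (abs_lt_sqrt_sq_add_sq (momentQuotient t ε x) (y := 1 + x) (by linarith))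
  exact Real.sqrt_pos.2 (by linarith)

lemma contDiffAt_profile (t : ℝ) (hε : ε = 1 ∨ ε = -1) {x : ℝ} (hx : -1 < x) :
    ContDiffAt ℝ ∞ (profileU t ε) x ∧ ContDiffAt ℝ ∞ (profileV t ε) x := by
  have hn := (contDiff_momentQuotient t hε).contDiffAt (x := x)
  have h1 : 0 < 1 + x := by linarith
  have hs : ContDiffAt ℝ ∞ (fun x => √(momentQuotient t ε x ^ 2 + (1 + x) ^ 2)) x :=
    ((hn.pow 2).add ((contDiffAt_const.add contDiffAt_id).pow 2)).sqrt
      (by simp only [id]; positivity)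
  exact ⟨(hn.add hs).sqrt (Real.sqrt_pos.1 (profileU_pos t ε hx)).ne',
    (hn.neg.add hs).sqrt (Real.sqrt_pos.1 (profileV_pos t ε hx)).ne'⟩

lemma profileU_sq (t ε : ℝ) {x : ℝ} (hx : -1 < x) : profileU t ε x ^ 2 =
    momentQuotient t ε x + √(momentQuotient t ε x ^ 2 + (1 + x) ^ 2) :=
  Real.sq_sqrt (Real.sqrt_pos.1 (profileU_pos t ε hx)).le

lemma profileV_sq (t ε : ℝ) {x : ℝ} (hx : -1 < x) : profileV t ε x ^ 2 =
    -momentQuotient t ε x + √(momentQuotient t ε x ^ 2 + (1 + x) ^ 2) :=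
  Real.sq_sqrt (Real.sqrt_pos.1 (profileV_pos t ε hx)).le

lemma profileU_sq_sub_profileV_sq (t ε : ℝ) {x : ℝ} (hx : -1 < x) :
    profileU t ε x ^ 2 - profileV t ε x ^ 2 = 2 * momentQuotient t ε x := by
  rw [profileU_sq t ε hx, profileV_sq t ε hx]; ring

lemma profileU_mul_profileV (t ε : ℝ) {x : ℝ} (hx : -1 < x) :
    profileU t ε x * profileV t ε x = 1 + x := by
  refine (pow_left_inj₀ (mul_pos (profileU_pos t ε hx) (profileV_pos t ε hx)).le
    (by linarith) two_ne_zero).1 ?_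
  rw [mul_pow, profileU_sq t ε hx, profileV_sq t ε hx]
  have := Real.sq_sqrt (x := momentQuotient t ε x ^ 2 + (1 + x) ^ 2) (by positivity)
  linear_combination this

/-- The derivatives of the profile functions satisfy the differential equation which makes the core
Lagrangian. -/
lemma deriv_profile (t : ℝ) (hε : ε = 1 ∨ ε = -1) {x : ℝ} (hx : -1 < x) :
    (1 - x) * (profileU t ε x * deriv (profileU t ε) x - profileV t ε x * deriv (profileV t ε) x)
      - momentQuotient t ε x = -(t * (ε * deriv cutoff (ε * x))) := by
  obtain ⟨hU, hV⟩ := contDiffAt_profile t hε hx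
  have hU := (hU.differentiableAt (by simp)).hasDerivAt
  have hV := (hV.differentiableAt (by simp)).hasDerivAt
  have hn := ((contDiff_momentQuotient t hε).differentiable (by simp) x).hasDerivAt
  have e1 : (fun x => profileU t ε x ^ 2 - profileV t ε x ^ 2) =ᶠ[𝓝 x]
      fun x => 2 * momentQuotient t ε x := by
    filter_upwards [Ioi_mem_nhds hx] with y hy using profileU_sq_sub_profileV_sq t ε hy
  have d1 := (((hU.pow 2).sub (hV.pow 2)).congr_of_eventuallyEq e1.symm).unique (hn.const_mul 2)
  have hχ : HasDerivAt (fun x => t * (cutoff ε - cutoff (ε * x)))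
      (-(t * (ε * deriv cutoff (ε * x)))) x :=
    ((((hasDerivAt_cutoff (ε * x)).comp x ((hasDerivAt_id x).const_mul ε)).const_sub
      (cutoff ε)).const_mul t).congr_deriv (by ring)
  have e2 : (fun x => (1 - x) * momentQuotient t ε x) =
      fun x => t * (cutoff ε - cutoff (ε * x)) := funext (one_sub_mul_momentQuotient t ε)
  have d2 := (((hasDerivAt_id x).const_sub 1).mul hn).unique (hχ.congr_of_eventuallyEq
    (Eventually.of_forall fun y => congrFun e2 y))
  simp only [Nat.cast_ofNat, Nat.reduceSub, pow_one] at d1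
  simp only [id] at d2
  linear_combination (1 - x) / 2 * d1 + d2

/-! ### The core spheres -/

/-- The map whose restriction to the unit sphere of `ℂ²` parametrises the core over the segment from
`0` to `ε`; the coordinate `p` generates the vanishing cycle over `ε`, and `q` that over `0`. -/
noncomputable def sphereModel (t ε : ℝ) (y : ℂ × ℂ) : Amb :=
  ![profileU t ε (Complex.normSq y.2) * y.1,
    -(profileV t ε (Complex.normSq y.2) * (starRingEnd ℂ) y.1),
    y.2, ε * (starRingEnd ℂ) y.2, ((ε * Complex.normSq y.2 : ℝ) : ℂ)]

/-- The core in terms of the moments `|u₁|² - |v₁|²` and `|u₂|² - |v₂|²` of the circle factors. -/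
def momentSphere (t ε : ℝ) : Set Amb :=
  {w | w ∈ W₀ ∧ ∃ x ∈ Icc (0 : ℝ) 1, w 4 = ((ε * x : ℝ) : ℂ) ∧
    Complex.normSq (w 0) - Complex.normSq (w 1) = 2 * (t * (cutoff ε - cutoff (ε * x))) ∧
    Complex.normSq (w 2) = Complex.normSq (w 3)}

lemma neg_one_lt_normSq (q : ℂ) : -1 < Complex.normSq q := by
  linarith [Complex.normSq_nonneg q]

lemma sphereModel_mem (t : ℝ) (hε : ε = 1 ∨ ε = -1) {y : ℂ × ℂ}
    (hy : Complex.normSq y.1 + Complex.normSq y.2 = 1) : sphereModel t ε y ∈ momentSphere t ε := by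
  have hx := neg_one_lt_normSq y.2
  have hUV := profileU_mul_profileV t ε hx
  have hn := one_sub_mul_momentQuotient t ε (Complex.normSq y.2)
  have hd := profileU_sq_sub_profileV_sq t ε hx
  have hε2 : ε ^ 2 = 1 := by rcases hε with rfl | rfl <;> norm_num
  have h1 : Complex.normSq y.1 = 1 - Complex.normSq y.2 := by linarith
  refine ⟨⟨?_, ?_⟩, Complex.normSq y.2, ⟨Complex.normSq_nonneg _, ?_⟩, rfl, ?_, ?_⟩
  · have hUV' : (profileU t ε (Complex.normSq y.2) * profileV t ε (Complex.normSq y.2) : ℂ)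
        = 1 + Complex.normSq y.2 := by exact_mod_cast hUV
    have hε2' : (ε : ℂ) ^ 2 = 1 := by exact_mod_cast hε2
    have h1' : (Complex.normSq y.1 : ℂ) = 1 - Complex.normSq y.2 := by exact_mod_cast h1
    have h2 := Complex.mul_conj y.1
    simp only [sphereModel, Matrix.cons_val_zero, Matrix.cons_val_one, Matrix.cons_val,
      Complex.ofReal_mul]
    linear_combination (-y.1 * (starRingEnd ℂ) y.1) * hUV' - (1 + Complex.normSq y.2 : ℂ) * h2
      - (1 + Complex.normSq y.2 : ℂ) * h1' - (Complex.normSq y.2 : ℂ) ^ 2 * hε2'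
  · have h2 := Complex.mul_conj y.2
    simp only [sphereModel, Matrix.cons_val, Complex.ofReal_mul]
    linear_combination (ε : ℂ) * h2
  · linarith [Complex.normSq_nonneg y.1]
  · simp only [sphereModel, Matrix.cons_val_zero, Matrix.cons_val_one, Complex.normSq_mul,
      Complex.normSq_neg, Complex.normSq_conj, Complex.normSq_ofReal]
    linear_combination (Complex.normSq y.1) * hd + 2 * hn + 2 * momentQuotient t ε
      (Complex.normSq y.2) * h1
  · simp only [sphereModel, Matrix.cons_val, Complex.normSq_mul, Complex.normSq_conj,
      Complex.normSq_ofReal]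
    linear_combination -Complex.normSq y.2 * hε2

lemma exists_of_mem_momentSphere (hε : ε = 1 ∨ ε = -1) {w : Amb} (hw : w ∈ momentSphere t ε) :
    ∃ y : ℂ × ℂ, Complex.normSq y.1 + Complex.normSq y.2 = 1 ∧ sphereModel t ε y = w := by
  obtain ⟨⟨h1, h2⟩, x, ⟨hx0, hx1⟩, h4, hm, h23⟩ := hw
  have hε2 : ε ^ 2 = 1 := by rcases hε with rfl | rfl <;> norm_num
  have hx : -1 < x := by linarith
  have hU := profileU_pos t ε hx
  have hUV := profileU_mul_profileV t ε hx
  have hn := one_sub_mul_momentQuotient t ε x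
  have hd := profileU_sq_sub_profileV_sq t ε hx
  -- `|u₂|² = x`
  have hq : Complex.normSq (w 2) = x := by
    have := congrArg Complex.normSq h2
    rw [Complex.normSq_mul, ← h23, h4, Complex.normSq_ofReal] at this
    refine (pow_left_inj₀ (Complex.normSq_nonneg _) hx0 two_ne_zero).1 ?_
    linear_combination this + x ^ 2 * hε2
  -- `|u₁|²` is determined by the moment and the product of `|u₁|²` and `|v₁|²`
  have hprod : Complex.normSq (w 0) * Complex.normSq (w 1) = ((1 - x) * (1 + x)) ^ 2 := by
    have := congrArg Complex.normSq h1
    rw [Complex.normSq_mul, h4, ← Complex.ofReal_pow, ← Complex.ofReal_one, ← Complex.ofReal_sub,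
      Complex.normSq_ofReal] at this
    linear_combination this + (x ^ 2 * (ε ^ 2 * x ^ 2 + x ^ 2 - 2)) * hε2
  have hN := Complex.normSq_nonneg (w 0)
  have hN1 := Complex.normSq_nonneg (w 1)
  have hG : 0 ≤ (1 - x) * profileU t ε x ^ 2 := mul_nonneg (by linarith) (sq_nonneg _)
  have hG1 : 0 ≤ (1 - x) * profileV t ε x ^ 2 := mul_nonneg (by linarith) (sq_nonneg _)
  have hp : Complex.normSq (w 0) = (1 - x) * profileU t ε x ^ 2 := by
    have hfac : (Complex.normSq (w 0) - (1 - x) * profileU t ε x ^ 2)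
        * (Complex.normSq (w 0) + (1 - x) * profileV t ε x ^ 2) = 0 := by
      linear_combination hprod + Complex.normSq (w 0) * hm
        - (1 - x) * Complex.normSq (w 0) * hd - 2 * Complex.normSq (w 0) * hn
        - (1 - x) ^ 2 * (profileU t ε x * profileV t ε x + 1 + x) * hUV
    rcases mul_eq_zero.1 hfac with h | h
    · linarith
    · nlinarith
  have hUC : (profileU t ε x : ℂ) ≠ 0 := by exact_mod_cast hU.ne'
  have hUVC : (profileU t ε x * profileV t ε x : ℂ) = 1 + x := by exact_mod_cast hUV
  have hεC : (ε : ℂ) ^ 2 = 1 := by exact_mod_cast hε2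
  refine ⟨(w 0 / profileU t ε x, w 2), ?_, ?_⟩
  · rw [Complex.normSq_div, Complex.normSq_ofReal, hp, hq]
    field_simp
    ring
  · have c0 : (profileU t ε x : ℂ) * (w 0 / profileU t ε x) = w 0 := by field_simp
    have c1 : -(profileV t ε x * (starRingEnd ℂ) (w 0 / profileU t ε x)) = w 1 := by
      by_cases h0 : w 0 = 0
      · rw [h0, Complex.normSq_zero] at hp
        have : 1 - x = 0 := by
          rcases mul_eq_zero.1 hp.symm with h | h
          · exact h
          · exact absurd h (pow_ne_zero 2 hU.ne')
        rw [h0, Complex.normSq_zero, ← hn, this] at hm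
        have : w 1 = 0 := Complex.normSq_eq_zero.1 (by linarith)
        simp [h0, this]
      · have hc := Complex.mul_conj (w 0)
        rw [hp] at hc
        push_cast at hc
        refine mul_left_cancel₀ h0 ?_
        rw [h1, h4, map_div₀, Complex.conj_ofReal]
        push_cast
        field_simp
        linear_combination -(profileV t ε x : ℂ) * hc - (1 - x : ℂ) * (profileU t ε x) * hUVC
          - (profileU t ε x : ℂ) * x ^ 2 * hεC
    have c3 : (ε : ℂ) * (starRingEnd ℂ) (w 2) = w 3 := by
      by_cases h0 : w 2 = 0
      · rw [h0, Complex.normSq_zero] at h23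
        rw [h0, Complex.normSq_eq_zero.1 h23.symm, map_zero, mul_zero]
      · have hc := Complex.mul_conj (w 2)
        rw [hq] at hc
        refine mul_left_cancel₀ h0 ?_
        rw [h2, h4]
        push_cast
        linear_combination (ε : ℂ) * hc
    ext i
    fin_cases i
    · simpa [sphereModel, hq] using c0
    · simpa [sphereModel, hq] using c1
    · rfl
    · simpa [sphereModel] using c3
    · simp [sphereModel, hq, h4]

lemma contDiff_normSq : ContDiff ℝ ∞ Complex.normSq := by
  have : (Complex.normSq : ℂ → ℝ) = fun z => ‖z‖ ^ 2 := by
    ext z; exact Complex.normSq_eq_norm_sq z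
  rw [this]
  exact contDiff_norm_sq ℝ

lemma hasDerivAt_normSq {c : ℝ → ℂ} {ξ : ℂ} {s : ℝ} (h : HasDerivAt c ξ s) :
    HasDerivAt (fun s => Complex.normSq (c s)) (2 * ((c s).re * ξ.re + (c s).im * ξ.im)) s := by
  have r : HasDerivAt (fun s => (c s).re) ξ.re s := Complex.reCLM.hasFDerivAt.comp_hasDerivAt s h
  have i : HasDerivAt (fun s => (c s).im) ξ.im s := Complex.imCLM.hasFDerivAt.comp_hasDerivAt s h
  exact ((r.mul r).add (i.mul i)).congr_deriv (by ring)

lemma contDiff_sphereModel (t : ℝ) (hε : ε = 1 ∨ ε = -1) : ContDiff ℝ ∞ (sphereModel t ε) := by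
  have hN : ContDiff ℝ ∞ fun y : ℂ × ℂ => Complex.normSq y.2 := contDiff_normSq.comp contDiff_snd
  have hU : ContDiff ℝ ∞ fun y : ℂ × ℂ => (profileU t ε (Complex.normSq y.2) : ℂ) :=
    Complex.ofRealCLM.contDiff.comp (contDiff_iff_contDiffAt.2 fun y =>
      ContDiffAt.comp (g := profileU t ε) y
        (contDiffAt_profile t hε (neg_one_lt_normSq y.2)).1 hN.contDiffAt)
  have hV : ContDiff ℝ ∞ fun y : ℂ × ℂ => (profileV t ε (Complex.normSq y.2) : ℂ) :=
    Complex.ofRealCLM.contDiff.comp (contDiff_iff_contDiffAt.2 fun y =>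
      ContDiffAt.comp (g := profileV t ε) y
        (contDiffAt_profile t hε (neg_one_lt_normSq y.2)).2 hN.contDiffAt)
  have hconj : ContDiff ℝ ∞ (starRingEnd ℂ) := Complex.conjCLE.contDiff
  rw [contDiff_pi]
  intro i
  fin_cases i
  · exact hU.mul contDiff_fst
  · exact (hV.mul (hconj.comp contDiff_fst)).neg
  · exact contDiff_snd
  · exact contDiff_const.mul (hconj.comp contDiff_snd)
  · exact Complex.ofRealCLM.contDiff.comp (contDiff_const.mul hN)

lemma fderiv_sphereModel (t : ℝ) (hε : ε = 1 ∨ ε = -1) (y a : ℂ × ℂ) :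
    fderiv ℝ (sphereModel t ε) y a =
      ![profileU t ε (Complex.normSq y.2) * a.1
          + (deriv (profileU t ε) (Complex.normSq y.2) *
            (2 * (y.2.re * a.2.re + y.2.im * a.2.im)) : ℝ) * y.1,
        -(profileV t ε (Complex.normSq y.2) * (starRingEnd ℂ) a.1
          + (deriv (profileV t ε) (Complex.normSq y.2) *
            (2 * (y.2.re * a.2.re + y.2.im * a.2.im)) : ℝ) * (starRingEnd ℂ) y.1),
        a.2, ε * (starRingEnd ℂ) a.2,
        ((ε * (2 * (y.2.re * a.2.re + y.2.im * a.2.im)) : ℝ) : ℂ)] := by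
  have hl : HasDerivAt (fun s : ℝ => y + s • a) a 0 := by
    simpa using ((hasDerivAt_id (0 : ℝ)).smul_const a).const_add y
  have hd : HasFDerivAt (sphereModel t ε) (fderiv ℝ (sphereModel t ε) y) (y + (0 : ℝ) • a) := by
    simpa using ((contDiff_sphereModel t hε).differentiable (by simp) y).hasFDerivAt
  refine (hd.comp_hasDerivAt (0 : ℝ) hl).unique (hasDerivAt_pi.2 fun i => ?_)
  have h1 : HasDerivAt (fun s : ℝ => (y + s • a).1) a.1 0 :=
    (ContinuousLinearMap.fst ℝ ℂ ℂ).hasFDerivAt.comp_hasDerivAt 0 hl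
  have h2 : HasDerivAt (fun s : ℝ => (y + s • a).2) a.2 0 :=
    (ContinuousLinearMap.snd ℝ ℂ ℂ).hasFDerivAt.comp_hasDerivAt 0 hl
  have c1 : HasDerivAt (fun s : ℝ => (starRingEnd ℂ) (y + s • a).1) ((starRingEnd ℂ) a.1) 0 :=
    Complex.conjCLE.hasFDerivAt.comp_hasDerivAt 0 h1
  have c2 : HasDerivAt (fun s : ℝ => (starRingEnd ℂ) (y + s • a).2) ((starRingEnd ℂ) a.2) 0 :=
    Complex.conjCLE.hasFDerivAt.comp_hasDerivAt 0 h2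
  have hN : HasDerivAt (fun s : ℝ => Complex.normSq (y + s • a).2)
      (2 * (y.2.re * a.2.re + y.2.im * a.2.im)) 0 := by
    simpa using hasDerivAt_normSq h2
  have hP : ∀ f : ℝ → ℝ, DifferentiableAt ℝ f (Complex.normSq y.2) →
      HasDerivAt (fun s : ℝ => (f (Complex.normSq (y + s • a).2) : ℂ))
        ((deriv f (Complex.normSq y.2) * (2 * (y.2.re * a.2.re + y.2.im * a.2.im)) : ℝ) : ℂ) 0 := by
    intro f hf
    have hf' : HasDerivAt f (deriv f (Complex.normSq y.2))
        (Complex.normSq (y + (0 : ℝ) • a).2) := by simpa using hf.hasDerivAt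
    exact (hf'.comp (0 : ℝ) hN).ofReal_comp
  obtain ⟨sU, sV⟩ := contDiffAt_profile t hε (neg_one_lt_normSq y.2)
  have hU := hP _ (sU.differentiableAt (by simp))
  have hV := hP _ (sV.differentiableAt (by simp))
  fin_cases i
  · refine (hU.mul h1).congr_deriv ?_
    simp only [zero_smul, add_zero]
    exact add_comm _ _
  · refine (hV.mul c1).neg.congr_deriv ?_
    simp only [zero_smul, add_zero]
    exact congrArg Neg.neg (add_comm _ _)
  · exact h2
  · exact c2.const_mul (ε : ℂ)
  · exact (hN.const_mul ε).ofReal_comp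

lemma injective_fderiv_sphereModel (t : ℝ) (hε : ε = 1 ∨ ε = -1) (y : ℂ × ℂ) :
    Function.Injective (fderiv ℝ (sphereModel t ε) y) := by
  rw [injective_iff_map_eq_zero]
  intro a ha
  rw [fderiv_sphereModel t hε] at ha
  have h2 : a.2 = 0 := congrFun ha 2
  have h0 := congrFun ha 0
  have hU : (profileU t ε (Complex.normSq y.2) : ℂ) ≠ 0 := by
    exact_mod_cast (profileU_pos t ε (neg_one_lt_normSq y.2)).ne'
  have h1 : a.1 = 0 := by simpa [h2, hU] using h0
  exact Prod.ext h1 h2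

lemma injective_sphereModel (t ε : ℝ) : Function.Injective (sphereModel t ε) := by
  intro y y' h
  have h2 : y.2 = y'.2 := congrFun h 2
  have h0 : (profileU t ε (Complex.normSq y.2) : ℂ) * y.1
    = (profileU t ε (Complex.normSq y'.2) : ℂ) * y'.1 := congrFun h 0
  have hU : (profileU t ε (Complex.normSq y.2) : ℂ) ≠ 0 := by
    exact_mod_cast (profileU_pos t ε (neg_one_lt_normSq y.2)).ne'
  rw [← h2] at h0
  exact Prod.ext (mul_left_cancel₀ hU h0) h2

/-- The pullback of `dθ` by the parametrisation of the core is the angular form of `p`. -/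
lemma dTheta_sphereModel (t : ℝ) (hε : ε = 1 ∨ ε = -1) (y a : ℂ × ℂ) :
    Complex.normSq y.1 * dTheta (sphereModel t ε y) (fderiv ℝ (sphereModel t ε) y a) =
      y.1.re * a.1.im - y.1.im * a.1.re := by
  by_cases h0 : y.1 = 0
  · simp [h0]
  have hU : (profileU t ε (Complex.normSq y.2) : ℂ) ≠ 0 := by
    exact_mod_cast (profileU_pos t ε (neg_one_lt_normSq y.2)).ne'
  have hV : (profileV t ε (Complex.normSq y.2) : ℂ) ≠ 0 := by
    exact_mod_cast (profileV_pos t ε (neg_one_lt_normSq y.2)).ne'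
  have h0' : (starRingEnd ℂ) y.1 ≠ 0 := by simpa using h0
  rw [dTheta_apply, fderiv_sphereModel t hε]
  simp only [sphereModel, Matrix.cons_val_zero, Matrix.cons_val_one]
  generalize (profileU t ε (Complex.normSq y.2)) = A at *
  generalize (profileV t ε (Complex.normSq y.2)) = B at *
  generalize deriv (profileU t ε) (Complex.normSq y.2) *
            (2 * (y.2.re * a.2.re + y.2.im * a.2.im)) = A'
  generalize deriv (profileV t ε) (Complex.normSq y.2) *
            (2 * (y.2.re * a.2.re + y.2.im * a.2.im)) = B'
  have e : (A * y.1 : ℂ)⁻¹ * (A * a.1 + A' * y.1) -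
      (-(B * (starRingEnd ℂ) y.1) : ℂ)⁻¹ * -(B * (starRingEnd ℂ) a.1 + B' * (starRingEnd ℂ) y.1)
      = (a.1 / y.1 - (starRingEnd ℂ) (a.1 / y.1)) + ((A' / A - B' / B : ℝ) : ℂ) := by
    rw [map_div₀]
    push_cast
    field_simp
    ring
  have hN : Complex.normSq y.1 ≠ 0 := by simpa using h0
  rw [e, Complex.add_im, Complex.sub_im, Complex.conj_im, Complex.ofReal_im, Complex.div_im]
  field_simp
  ring

/-- The parametrisation of the core is isotropic on the tangent spaces of the unit sphere. -/
lemma omega_sphereModel (t : ℝ) (hε : ε = 1 ∨ ε = -1) {y a b : ℂ × ℂ}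
    (hy : Complex.normSq y.1 + Complex.normSq y.2 = 1)
    (ha : y.1.re * a.1.re + y.1.im * a.1.im + (y.2.re * a.2.re + y.2.im * a.2.im) = 0)
    (hb : y.1.re * b.1.re + y.1.im * b.1.im + (y.2.re * b.2.re + y.2.im * b.2.im) = 0) :
    omega t (sphereModel t ε y)
      ![fderiv ℝ (sphereModel t ε) y a, fderiv ℝ (sphereModel t ε) y b] = 0 := by
  have hx := neg_one_lt_normSq y.2
  have hn := deriv_profile t hε hx
  have hd := profileU_sq_sub_profileV_sq t ε hx
  have hε2 : ε ^ 2 = 1 := by rcases hε with rfl | rfl <;> norm_num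
  have ta := dTheta_sphereModel t hε y a
  have tb := dTheta_sphereModel t hε y b
  have h1 : Complex.normSq y.1 = 1 - Complex.normSq y.2 := by linarith
  have h4 : (sphereModel t ε y 4).re = ε * Complex.normSq y.2 := Complex.ofReal_re _
  rw [omega_apply, h4, Fin.sum_univ_five]
  generalize dTheta (sphereModel t ε y) (fderiv ℝ (sphereModel t ε) y a) = Ta at *
  generalize dTheta (sphereModel t ε y) (fderiv ℝ (sphereModel t ε) y b) = Tb at *
  rw [fderiv_sphereModel t hε, fderiv_sphereModel t hε]
  have hxa : y.2.re * a.2.re + y.2.im * a.2.im = -(y.1.re * a.1.re + y.1.im * a.1.im) := by linarith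
  have hxb : y.2.re * b.2.re + y.2.im * b.2.im = -(y.1.re * b.1.re + y.1.im * b.1.im) := by linarith
  rw [hxa, hxb]
  have hp : Complex.normSq y.1 = y.1.re * y.1.re + y.1.im * y.1.im := Complex.normSq_apply _
  simp only [Matrix.cons_val_zero, Matrix.cons_val_one, Matrix.cons_val, Complex.add_re,
    Complex.add_im, Complex.neg_re, Complex.neg_im, Complex.re_ofReal_mul, Complex.im_ofReal_mul,
    Complex.conj_re, Complex.conj_im, Complex.ofReal_re, Complex.ofReal_im]
  generalize (profileU t ε (Complex.normSq y.2)) = A at *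
  generalize (profileV t ε (Complex.normSq y.2)) = B at *
  generalize deriv (profileU t ε) (Complex.normSq y.2) = A' at *
  generalize deriv (profileV t ε) (Complex.normSq y.2) = B' at *
  -- where `p = 0` the angular form of `p` is undefined, but `χ' = 0` there
  by_cases h0 : y.1 = 0
  · have hχ : deriv cutoff (ε * Complex.normSq y.2) = 0 := by
      have hx1 : Complex.normSq y.2 = 1 := by simpa [h0] using hy
      rw [hx1]
      rcases hε with rfl | rfl
      · exact deriv_cutoff_of_gt (by norm_num)
      · exact deriv_cutoff_of_lt (by norm_num)
    have hx0 : 1 - Complex.normSq y.2 = 0 := by rw [← h1, h0, map_zero]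
    rw [hx0, hχ] at hn
    simp only [h0, hχ, Complex.zero_re, Complex.zero_im]
    linear_combination (a.1.re * b.1.im - a.1.im * b.1.re) * (hd - 2 * hn)
      - (a.2.re * b.2.im - b.2.re * a.2.im) * hε2
  have hN : Complex.normSq y.1 ≠ 0 := by simpa using h0
  refine (mul_eq_zero_iff_left hN).1 ?_
  -- on the sphere `2 Re(p̄ dp) = -dx`, so `|p|²` times the area form of `p` is a multiple of
  -- `dx ∧ |p|² dθ`, like the other terms, and `hn` says that the coefficients add up to zero
  linear_combination
    (2 * (y.1.re * b.1.re + y.1.im * b.1.im) * (y.1.re * a.1.im - y.1.im * a.1.re)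
      - 2 * (y.1.re * a.1.re + y.1.im * a.1.im) * (y.1.re * b.1.im - y.1.im * b.1.re)) *
      (hn - hd / 2 + (A * A' - B * B') * h1)
    + t * deriv cutoff (ε * Complex.normSq y.2) * ε *
      (2 * (y.1.re * b.1.re + y.1.im * b.1.im) * ta - 2 * (y.1.re * a.1.re + y.1.im * a.1.im) * tb)
    + (A ^ 2 - B ^ 2) * (a.1.re * b.1.im - a.1.im * b.1.re) * hp
    - Complex.normSq y.1 * (a.2.re * b.2.im - b.2.re * a.2.im) * hε2

/-! ### The cores as Lagrangian spheres -/

/-- The identification of `ℝ⁴` with `ℂ²`. -/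
noncomputable def toComplexPair : EuclideanSpace ℝ (Fin 4) →L[ℝ] ℂ × ℂ :=
  LinearMap.toContinuousLinearMap
    { toFun := fun y => (⟨y 0, y 1⟩, ⟨y 2, y 3⟩)
      map_add' := fun _ _ => rfl
      map_smul' := fun c y => by ext <;> simp [Complex.ext_iff] }

lemma toComplexPair_apply (y : EuclideanSpace ℝ (Fin 4)) :
    toComplexPair y = (⟨y 0, y 1⟩, ⟨y 2, y 3⟩) := rfl

lemma injective_toComplexPair : Function.Injective toComplexPair := by
  intro y y' h
  simp only [toComplexPair_apply, Prod.mk.injEq, Complex.mk.injEq] at h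
  ext i
  fin_cases i
  exacts [h.1.1, h.1.2, h.2.1, h.2.2]

lemma normSq_toComplexPair (y : EuclideanSpace ℝ (Fin 4)) :
    Complex.normSq (toComplexPair y).1 + Complex.normSq (toComplexPair y).2 = ‖y‖ ^ 2 := by
  rw [EuclideanSpace.norm_sq_eq, Fin.sum_univ_four, toComplexPair_apply]
  simp [Complex.normSq_mk]
  ring

lemma finrank_euclidean_four : Fact (Module.finrank ℝ (EuclideanSpace ℝ (Fin 4)) = 3 + 1) :=
  ⟨finrank_euclideanSpace_fin⟩

lemma contMDiff_coe_sphere3 :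
    ContMDiff (𝓡 3) 𝓘(ℝ, EuclideanSpace ℝ (Fin 4)) ∞
      ((↑) : Sphere3 → EuclideanSpace ℝ (Fin 4)) :=
  have := finrank_euclidean_four
  contMDiff_coe_sphere

lemma injective_mvfderiv_coe_sphere3 (x : Sphere3) :
    Function.Injective (mvfderiv (𝓡 3) ((↑) : Sphere3 → EuclideanSpace ℝ (Fin 4)) x) :=
  have := finrank_euclidean_four
  injective_mvfderiv_subtypeVal_sphere x

lemma mvfderiv_coe_sphere3_mem (x : Sphere3) (a : TangentSpace (𝓡 3) x) :
    mvfderiv (𝓡 3) ((↑) : Sphere3 → EuclideanSpace ℝ (Fin 4)) x a ∈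
      (Submodule.span ℝ {(x : EuclideanSpace ℝ (Fin 4))})ᗮ := by
  have := finrank_euclidean_four
  have h := range_mvfderiv_subtypeVal (n := 3) x
  exact h ▸ ⟨a, rfl⟩

/-- The inclusion of the unit sphere of `ℝ⁴` into `ℂ²`. -/
noncomputable def spherePair (x : Sphere3) : ℂ × ℂ := toComplexPair x

lemma contMDiff_spherePair : ContMDiff (𝓡 3) 𝓘(ℝ, ℂ × ℂ) ∞ spherePair :=
  toComplexPair.contDiff.contMDiff.comp contMDiff_coe_sphere3

lemma mfderiv_spherePair (x : Sphere3) (a : TangentSpace (𝓡 3) x) :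
    mfderiv (𝓡 3) 𝓘(ℝ, ℂ × ℂ) spherePair x a =
      toComplexPair (mvfderiv (𝓡 3) ((↑) : Sphere3 → EuclideanSpace ℝ (Fin 4)) x a) := by
  have h : mfderiv (𝓡 3) 𝓘(ℝ, ℂ × ℂ)
      (toComplexPair ∘ ((↑) : Sphere3 → EuclideanSpace ℝ (Fin 4))) x = _ :=
    mfderiv_comp x ((toComplexPair.contMDiff (n := 1)).mdifferentiableAt one_ne_zero)
      (contMDiff_coe_sphere3.mdifferentiableAt (by simp))
  rw [mfderiv_eq_fderiv, toComplexPair.fderiv] at h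
  exact congrArg (fun l => l a) h

/-- The tangent space of the unit sphere at `x` is orthogonal to `x`. -/
lemma orthogonal_mfderiv_spherePair (x : Sphere3) (a : TangentSpace (𝓡 3) x) (b : ℂ × ℂ)
    (hb : b = mfderiv (𝓡 3) 𝓘(ℝ, ℂ × ℂ) spherePair x a) :
    (spherePair x).1.re * b.1.re + (spherePair x).1.im * b.1.im
      + ((spherePair x).2.re * b.2.re + (spherePair x).2.im * b.2.im) = 0 := by
  have h := mvfderiv_coe_sphere3_mem x a
  rw [Submodule.mem_orthogonal_singleton_iff_inner_right] at h
  rw [hb, mfderiv_spherePair]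
  generalize mvfderiv (𝓡 3) ((↑) : Sphere3 → EuclideanSpace ℝ (Fin 4)) x a = v at h
  rw [PiLp.inner_apply, Fin.sum_univ_four] at h
  simp only [spherePair, toComplexPair_apply]
  simp at h
  linarith

lemma injective_mfderiv_spherePair (x : Sphere3) :
    Function.Injective (mfderiv (𝓡 3) 𝓘(ℝ, ℂ × ℂ) spherePair x) := by
  intro a b h
  rw [mfderiv_spherePair, mfderiv_spherePair] at h
  exact injective_mvfderiv_coe_sphere3 x (injective_toComplexPair h)

/-- The sphere in `W₀` cut out by the moments is a Lagrangian 3-sphere. -/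
lemma isLagrangianSphere_momentSphere (t : ℝ) (hε : ε = 1 ∨ ε = -1) :
    IsLagrangianSphere (omega t) (momentSphere t ε) := by
  have hnorm : ∀ x : Sphere3,
      Complex.normSq (spherePair x).1 + Complex.normSq (spherePair x).2 = 1 := fun x => by
    rw [spherePair, normSq_toComplexPair, norm_eq_of_mem_sphere, one_pow]
  have hder : ∀ (x : Sphere3) (a : TangentSpace (𝓡 3) x),
      mfderiv (𝓡 3) 𝓘(ℝ, Amb) (sphereModel t ε ∘ spherePair) x a =
        fderiv ℝ (sphereModel t ε) (spherePair x)
          (mfderiv (𝓡 3) 𝓘(ℝ, ℂ × ℂ) spherePair x a) := fun x a => by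
    rw [mfderiv_comp x ((contDiff_sphereModel t hε).contMDiff.mdifferentiableAt (by simp))
      (contMDiff_spherePair.mdifferentiableAt (by simp)), mfderiv_eq_fderiv]
    rfl
  refine ⟨fun w hw => hw.1, sphereModel t ε ∘ spherePair,
    (contDiff_sphereModel t hε).contMDiff.comp contMDiff_spherePair, ?_, fun x => ?_, ?_,
    fun x a b => ?_⟩
  · exact (injective_sphereModel t ε).comp (injective_toComplexPair.comp Subtype.val_injective)
  · intro a b h
    rw [hder, hder] at h
    exact injective_mfderiv_spherePair x (injective_fderiv_sphereModel t hε _ h)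
  · ext w
    constructor
    · rintro ⟨x, rfl⟩
      exact sphereModel_mem t hε (hnorm x)
    · intro hw
      obtain ⟨y, hy, rfl⟩ := exists_of_mem_momentSphere hε hw
      let z : EuclideanSpace ℝ (Fin 4) := !₂[y.1.re, y.1.im, y.2.re, y.2.im]
      have hz : toComplexPair z = y := rfl
      have hz1 : ‖z‖ = 1 := by
        refine (pow_left_inj₀ (norm_nonneg _) zero_le_one two_ne_zero).1 ?_
        rw [← normSq_toComplexPair, hz, hy, one_pow]
      exact ⟨⟨z, by simpa using hz1⟩, congrArg (sphereModel t ε) hz⟩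
  · rw [hder, hder]
    exact omega_sphereModel t hε (hnorm x) (orthogonal_mfderiv_spherePair x a _ rfl)
      (orthogonal_mfderiv_spherePair x b _ rfl)

/-! ### Parallel transport along the real axis -/

lemma eq_of_hasDerivAt_zero {f : ℝ → ℝ} (hc : ContinuousOn f (Icc 0 1))
    (hd : ∀ s ∈ Ioo (0 : ℝ) 1, HasDerivAt f 0 s) {a b : ℝ} (ha : a ∈ Icc (0 : ℝ) 1)
    (hb : b ∈ Icc (0 : ℝ) 1) : f a = f b := by
  wlog hab : a < b generalizing a b
  · rcases (not_lt.1 hab).eq_or_lt with h | h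
    · rw [h]
    · exact (this hb ha h).symm
  obtain ⟨c, -, h⟩ := exists_hasDerivAt_eq_slope f (fun _ => 0) hab
    (hc.mono (Icc_subset_Icc ha.1 hb.2))
    fun s hs => hd s ⟨ha.1.trans_lt hs.1, hs.2.trans_le hb.2⟩
  have : b - a ≠ 0 := by linarith
  field_simp at h
  linarith

/-- A horizontal vector changes the first moment `|u₁|² - |v₁|²` at a rate determined by the
deformation: it is `ω_t`-orthogonal to the generator of the rotation of the first circle factor. -/
lemma IsHorizontal.moment_fst {w ξ : Amb} (h : IsHorizontal (omega t) w ξ) (h0 : w 0 ≠ 0)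
    (h1 : w 1 ≠ 0) :
    (w 0).re * (ξ 0).re + (w 0).im * (ξ 0).im - ((w 1).re * (ξ 1).re + (w 1).im * (ξ 1).im)
      = -(t * deriv cutoff (w 4).re * (ξ 4).re) := by
  have h2 := h.2 ![Complex.I * w 0, -(Complex.I * w 1), 0, 0, 0]
    (mem_tangent.2 ⟨by simp; ring, by simp⟩) (by simp)
  have hθ : dTheta w ![Complex.I * w 0, -(Complex.I * w 1), 0, 0, 0] = 1 := by
    have e : (w 0)⁻¹ * (Complex.I * w 0) - (w 1)⁻¹ * -(Complex.I * w 1) = 2 * Complex.I := by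
      field_simp
      ring
    rw [dTheta_apply]
    simp only [Matrix.cons_val_zero, Matrix.cons_val_one, e]
    simp
  rw [omega_apply, hθ, Fin.sum_univ_five] at h2
  simp at h2
  linarith

/-- Horizontal vectors preserve the second moment `|u₂|² - |v₂|²`. -/
lemma IsHorizontal.moment_snd {w ξ : Amb} (h : IsHorizontal (omega t) w ξ) :
    (w 2).re * (ξ 2).re + (w 2).im * (ξ 2).im
      - ((w 3).re * (ξ 3).re + (w 3).im * (ξ 3).im) = 0 := by
  have h2 := h.2 ![0, 0, Complex.I * w 2, -(Complex.I * w 3), 0]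
    (mem_tangent.2 ⟨by simp, by simp; ring⟩) (by simp)
  have hθ : dTheta w ![0, 0, Complex.I * w 2, -(Complex.I * w 3), 0] = 0 := by
    rw [dTheta_apply]; simp
  rw [omega_apply, hθ, Fin.sum_univ_five] at h2
  simp at h2
  linarith

/-- A radial vector whose first moment changes at the rate prescribed by the deformation, while the
second moment is constant, is horizontal. -/
lemma isHorizontal_of_radial {w ξ : Amb} (h0 : w 0 ≠ 0) (h1 : w 1 ≠ 0) (h2 : w 2 ≠ 0)
    (hξ : ξ ∈ tangent w) (r₀ r₁ r₂ : ℝ) (e0 : ξ 0 = r₀ * w 0) (e1 : ξ 1 = r₁ * w 1)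
    (e2 : ξ 2 = r₂ * w 2) (e3 : ξ 3 = r₂ * w 3)
    (hm : r₀ * Complex.normSq (w 0) - r₁ * Complex.normSq (w 1)
      = -(t * deriv cutoff (w 4).re * (ξ 4).re))
    (hm' : Complex.normSq (w 2) = Complex.normSq (w 3)) : IsHorizontal (omega t) w ξ := by
  refine ⟨hξ, fun η hη hη4 => ?_⟩
  obtain ⟨t1, t2⟩ := mem_tangent.1 hη
  rw [hη4] at t1 t2
  -- a vertical vector is a complex combination of the generators of the two rotations
  obtain ⟨k, hk⟩ : ∃ k, η 0 = k * w 0 := ⟨η 0 / w 0, by field_simp⟩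
  obtain ⟨l, hl⟩ : ∃ l, η 2 = l * w 2 := ⟨η 2 / w 2, by field_simp⟩
  have hk1 : η 1 = -(k * w 1) := by
    refine mul_left_cancel₀ h0 ?_
    rw [hk] at t1
    linear_combination t1
  have hl1 : η 3 = -(l * w 3) := by
    refine mul_left_cancel₀ h2 ?_
    rw [hl] at t2
    linear_combination t2
  have hθ : dTheta w η = k.im := by
    have e : (w 0)⁻¹ * η 0 - (w 1)⁻¹ * η 1 = 2 * k := by
      rw [hk, hk1]
      field_simp
      ring
    rw [dTheta_apply, e]
    simp
  rw [omega_apply, hθ, Fin.sum_univ_five, hη4, e0, e1, e2, e3, hk, hk1, hl, hl1]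
  simp only [Complex.neg_re, Complex.neg_im, Complex.mul_re, Complex.mul_im, Complex.ofReal_re,
    Complex.ofReal_im, Complex.zero_re, Complex.zero_im]
  rw [Complex.normSq_apply, Complex.normSq_apply] at hm hm'
  linear_combination k.im * hm + r₂ * l.im * hm'

lemma exists_eq_sqrt_mul (p : ℂ) : ∃ e : ℂ, Complex.normSq e = 1 ∧ p = √(Complex.normSq p) * e := by
  by_cases hp : p = 0
  · exact ⟨1, by simp, by simp [hp]⟩
  · have hn : Complex.normSq p ≠ 0 := by simpa using hp
    have hs : √(Complex.normSq p) ≠ 0 := by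
      rw [Real.sqrt_ne_zero (Complex.normSq_nonneg p)]; exact hn
    refine ⟨p / √(Complex.normSq p), ?_, ?_⟩
    · rw [Complex.normSq_div, Complex.normSq_ofReal, Real.mul_self_sqrt (Complex.normSq_nonneg p),
        div_self hn]
    · have hs' : (√(Complex.normSq p) : ℂ) ≠ 0 := by exact_mod_cast hs
      field_simp

lemma normSq_sqrt_mul {x : ℝ} (hx : 0 ≤ x) {e : ℂ} (he : Complex.normSq e = 1) :
    Complex.normSq (√x * e) = x := by
  rw [Complex.normSq_mul, he, Complex.normSq_ofReal, Real.mul_self_sqrt hx, mul_one]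

/-- The curves on the core along which the phases of `p` and `q` are constant are horizontal; here
`x = |q|² = ε (s + y₀)`. -/
lemma exists_radial_velocity (t : ℝ) (hε : ε = 1 ∨ ε = -1) (y₀ : ℝ) {e₁ e₂ : ℂ}
    (h1 : Complex.normSq e₁ = 1) (h2 : Complex.normSq e₂ = 1) {s : ℝ}
    (hs : ε * (s + y₀) ∈ Ioo (0 : ℝ) 1)
    (hmem : ∀ᶠ s in 𝓝 s, sphereModel t ε (√(1 - ε * (s + y₀)) * e₁, √(ε * (s + y₀)) * e₂) ∈ W₀) :
    ∃ ξ, HasDerivAt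
        (fun s : ℝ => sphereModel t ε (√(1 - ε * (s + y₀)) * e₁, √(ε * (s + y₀)) * e₂)) ξ s ∧
      IsHorizontal (omega t) (sphereModel t ε (√(1 - ε * (s + y₀)) * e₁, √(ε * (s + y₀)) * e₂)) ξ
    := by
  have hε2 : ε ^ 2 = 1 := by rcases hε with rfl | rfl <;> norm_num
  have hX : HasDerivAt (fun s : ℝ => ε * (s + y₀)) ε s := by
    simpa using ((hasDerivAt_id s).add_const y₀).const_mul ε
  have hp : HasDerivAt (fun s : ℝ => (√(1 - ε * (s + y₀)) * e₁ : ℂ))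
      ((-ε / (2 * √(1 - ε * (s + y₀))) : ℝ) * e₁) s :=
    ((hX.const_sub 1).sqrt (by linarith [hs.2])).ofReal_comp.mul_const e₁
  have hq : HasDerivAt (fun s : ℝ => (√(ε * (s + y₀)) * e₂ : ℂ))
      ((ε / (2 * √(ε * (s + y₀))) : ℝ) * e₂) s :=
    (hX.sqrt hs.1.ne').ofReal_comp.mul_const e₂
  have hd := (((contDiff_sphereModel t hε).differentiable (by simp)
    (√(1 - ε * (s + y₀)) * e₁, √(ε * (s + y₀)) * e₂)).hasFDerivAt).comp_hasDerivAt s (hp.prodMk hq)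
  refine ⟨_, hd, ?_⟩
  have htan := mem_tangent_of_hasDerivAt hd hmem
  have hN := normSq_sqrt_mul hs.1.le h2
  have hN1 := normSq_sqrt_mul (x := 1 - ε * (s + y₀)) (by linarith [hs.2]) h1
  have hx1 : -1 < ε * (s + y₀) := by linarith [hs.1]
  have hU := profileU_pos t ε hx1
  have hV := profileV_pos t ε hx1
  have hP := deriv_profile t hε hx1
  have hdiff := profileU_sq_sub_profileV_sq t ε hx1
  simp only [Function.comp_apply] at htan
  set X := ε * (s + y₀) with hXdef
  have hS0 : 0 < √X := Real.sqrt_pos.2 hs.1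
  have hS1 : 0 < √(1 - X) := Real.sqrt_pos.2 (by linarith [hs.2])
  have hq2 : 2 * ((√X * e₂ : ℂ).re * ((ε / (2 * √X) : ℝ) * e₂ : ℂ).re
      + (√X * e₂ : ℂ).im * ((ε / (2 * √X) : ℝ) * e₂ : ℂ).im) = ε := by
    rw [Complex.normSq_apply] at h2
    simp only [Complex.re_ofReal_mul, Complex.im_ofReal_mul]
    field_simp
    linear_combination ε * h2
  have hw := fderiv_sphereModel t hε (√(1 - X) * e₁, √X * e₂)
    ((-ε / (2 * √(1 - X)) : ℝ) * e₁, (ε / (2 * √X) : ℝ) * e₂)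
  simp only [hN, hq2] at hw
  rw [hw] at htan ⊢
  have he1 : e₁ ≠ 0 := by rintro rfl; simp at h1
  have he2 : e₂ ≠ 0 := by rintro rfl; simp at h2
  have cU : (profileU t ε X : ℂ) ≠ 0 := by exact_mod_cast hU.ne'
  have cV : (profileV t ε X : ℂ) ≠ 0 := by exact_mod_cast hV.ne'
  have cS0 : (√X : ℂ) ≠ 0 := by exact_mod_cast hS0.ne'
  have cS1 : (√(1 - X) : ℂ) ≠ 0 := by exact_mod_cast hS1.ne'
  have rX1 : 1 - X ≠ 0 := (sub_pos.2 hs.2).ne'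
  have i1 : -ε / (2 * √(1 - X)) = -ε / (2 * (1 - X)) * √(1 - X) := by
    rw [div_mul_eq_mul_div, div_eq_div_iff (by positivity) (by simpa using rX1)]
    linear_combination 2 * ε * Real.mul_self_sqrt (sub_pos.2 hs.2).le
  have i2 : ε / (2 * √X) = ε / (2 * X) * √X := by
    rw [div_mul_eq_mul_div, div_eq_div_iff (by positivity) (by simpa using hs.1.ne')]
    linear_combination -2 * ε * Real.mul_self_sqrt hs.1.le
  refine isHorizontal_of_radial ?_ ?_ ?_ htan
    (-ε / (2 * (1 - X)) + ε * deriv (profileU t ε) X / profileU t ε X)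
    (-ε / (2 * (1 - X)) + ε * deriv (profileV t ε) X / profileV t ε X) (ε / (2 * X))
    ?_ ?_ ?_ ?_ ?_ ?_
  all_goals simp only [sphereModel, hN, Matrix.cons_val_zero, Matrix.cons_val_one, Matrix.cons_val]
  · exact mul_ne_zero cU (mul_ne_zero cS1 he1)
  · exact neg_ne_zero.2 (mul_ne_zero cV (by simpa using ⟨hS1.ne', he1⟩))
  · exact mul_ne_zero cS0 he2
  · rw [i1]
    push_cast
    field_simp
  · rw [i1]
    simp only [map_mul, Complex.conj_ofReal]
    push_cast
    field_simp
  · rw [i2]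
    push_cast
    ring
  · rw [i2]
    simp only [map_mul, Complex.conj_ofReal]
    push_cast
    ring
  · rw [Complex.normSq_neg, Complex.normSq_mul (profileU t ε X : ℂ), hN1,
      Complex.normSq_mul (profileV t ε X : ℂ), Complex.normSq_conj, hN1,
      Complex.normSq_ofReal, Complex.normSq_ofReal, Complex.ofReal_re, Complex.ofReal_re]
    have d1 : (-ε / (2 * (1 - X)) + ε * deriv (profileU t ε) X / profileU t ε X) *
        (profileU t ε X * profileU t ε X * (1 - X)) = -ε / 2 * profileU t ε X ^ 2
          + ε * (1 - X) * (profileU t ε X * deriv (profileU t ε) X) := by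
      field_simp
    have d2 : (-ε / (2 * (1 - X)) + ε * deriv (profileV t ε) X / profileV t ε X) *
        (profileV t ε X * profileV t ε X * (1 - X)) = -ε / 2 * profileV t ε X ^ 2
          + ε * (1 - X) * (profileV t ε X * deriv (profileV t ε) X) := by
      field_simp
    rw [d1, d2]
    linear_combination -ε / 2 * hdiff + ε * hP
  · rw [Complex.normSq_mul, Complex.normSq_conj, hN, Complex.normSq_ofReal]
    linear_combination -X * hε2

/-- The velocity of a horizontal lift of a segment of the real axis. -/
lemma IsHorizontalLift.exists_velocity {y₀ : ℝ} {c : ℝ → Amb}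
    (hc : IsHorizontalLift (omega t) (fun s => ((s + y₀ : ℝ) : ℂ)) c) {s : ℝ}
    (hs : s ∈ Ioo (0 : ℝ) 1) :
    ∃ ξ, HasDerivAt c ξ s ∧ IsHorizontal (omega t) (c s) ξ ∧ ξ 4 = 1 := by
  obtain ⟨ξ, hd, hh⟩ := hc.horizontal s hs
  refine ⟨ξ, hd, hh, ?_⟩
  have e : (fun s => c s 4) =ᶠ[𝓝 s] fun s => ((s + y₀ : ℝ) : ℂ) := by
    filter_upwards [Ioo_mem_nhds hs.1 hs.2] with s' hs' using (hc.lifts s' ⟨hs'.1.le, hs'.2.le⟩).2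
  have h1 : HasDerivAt (fun s : ℝ => ((s + y₀ : ℝ) : ℂ)) 1 s := by
    simpa using ((hasDerivAt_id s).add_const y₀).ofReal_comp
  exact (hasDerivAt_pi.1 hd 4).unique (h1.congr_of_eventuallyEq e)

/-- A horizontal lift joining critical points stays in the sphere cut out by the moments, since
`|u₁|² - |v₁|² + 2 t χ(x)` and `|u₂|² - |v₂|²` are constant along it. -/
lemma IsHorizontalLift.mem_momentSphere {y₀ : ℝ} (hy : ε = 1 ∧ y₀ = 0 ∨ ε = -1 ∧ y₀ = -1)
    {c : ℝ → Amb} (hc : IsHorizontalLift (omega t) (fun s => ((s + y₀ : ℝ) : ℂ)) c)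
    (h0 : c 0 ∈ criticalSet) (h1 : c 1 ∈ criticalSet) {s : ℝ} (hs : s ∈ Icc (0 : ℝ) 1) :
    c s ∈ momentSphere t ε := by
  have hcont : ∀ j, ContinuousOn (fun s => c s j) (Icc 0 1) := fun j =>
    (continuous_apply j).comp_continuousOn hc.continuousOn
  have hN : Continuous Complex.normSq := Complex.continuous_normSq
  have hW : ∀ s ∈ Icc (0 : ℝ) 1, c s ∈ W₀ := fun s hs => (hc.lifts s hs).1
  have hz : ∀ s ∈ Icc (0 : ℝ) 1, c s 4 = ((s + y₀ : ℝ) : ℂ) := fun s hs => (hc.lifts s hs).2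
  have hχ : Continuous cutoff := contDiff_cutoff.continuous
  have m1 := @eq_of_hasDerivAt_zero (fun s => Complex.normSq (c s 0) - Complex.normSq (c s 1)
      + 2 * (t * cutoff (s + y₀))) (by
    refine ((hN.comp_continuousOn (hcont 0)).sub (hN.comp_continuousOn (hcont 1))).add
      (Continuous.continuousOn ?_)
    fun_prop) (fun s hs => by
      obtain ⟨ξ, hd, hh, h4⟩ := hc.exists_velocity hs
      have hs' := Ioo_subset_Icc_self hs
      have hre : (c s 4).re = s + y₀ := by rw [hz s hs', Complex.ofReal_re]
      have hne : c s 4 ^ 2 ≠ 1 := by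
        rw [hz s hs', ← Complex.ofReal_pow, Ne, Complex.ofReal_eq_one]
        obtain ⟨l, r⟩ := hs
        rcases hy with ⟨-, rfl⟩ | ⟨-, rfl⟩ <;> nlinarith
      obtain ⟨n0, n1⟩ := ne_zero_of_mem (hW s hs') hne
      have hm := hh.moment_fst n0 n1
      rw [hre, h4, Complex.one_re] at hm
      have hχ' : HasDerivAt (fun s => cutoff (s + y₀)) (deriv cutoff (s + y₀)) s :=
        (hasDerivAt_cutoff (s + y₀)).comp_add_const s y₀
      refine (((hasDerivAt_normSq (hasDerivAt_pi.1 hd 0)).sub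
        (hasDerivAt_normSq (hasDerivAt_pi.1 hd 1))).add
        ((hχ'.const_mul t).const_mul 2)).congr_deriv ?_
      linear_combination 2 * hm)
  have m2 := @eq_of_hasDerivAt_zero (fun s => Complex.normSq (c s 2) - Complex.normSq (c s 3))
    ((hN.comp_continuousOn (hcont 2)).sub (hN.comp_continuousOn (hcont 3))) (fun s hs => by
      obtain ⟨ξ, hd, hh, -⟩ := hc.exists_velocity hs
      refine ((hasDerivAt_normSq (hasDerivAt_pi.1 hd 2)).sub
        (hasDerivAt_normSq (hasDerivAt_pi.1 hd 3))).congr_deriv ?_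
      linear_combination 2 * hh.moment_snd)
  have i0 : (0 : ℝ) ∈ Icc (0 : ℝ) 1 := ⟨le_rfl, zero_le_one⟩
  have i1 : (1 : ℝ) ∈ Icc (0 : ℝ) 1 := ⟨zero_le_one, le_rfl⟩
  -- the end of the path over `0`
  have hA : ∀ s ∈ Icc (0 : ℝ) 1, c s ∈ criticalSet → s + y₀ = 0 →
      Complex.normSq (c s 2) - Complex.normSq (c s 3) = 0 := fun s hs hcr h => by
    have hz' := hz s hs
    rw [h, Complex.ofReal_zero] at hz'
    rcases (mem_criticalSet (hW s hs)).1 hcr with ⟨a, -⟩ | ⟨a, b⟩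
    · have := (hW s hs).1
      rw [a, hz'] at this
      norm_num at this
    · simp [a, b]
  -- the end of the path over `ε`
  have hB : ∀ s ∈ Icc (0 : ℝ) 1, c s ∈ criticalSet → s + y₀ = ε →
      Complex.normSq (c s 0) - Complex.normSq (c s 1) = 0 := fun s hs hcr h => by
    have hz' := hz s hs
    rw [h] at hz'
    rcases (mem_criticalSet (hW s hs)).1 hcr with ⟨a, b⟩ | ⟨a, -⟩
    · simp [a, b]
    · have := (hW s hs).2
      rw [a, hz', zero_mul, eq_comm, Complex.ofReal_eq_zero] at this
      rcases hy with ⟨rfl, -⟩ | ⟨rfl, -⟩ <;> norm_num at this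
  refine ⟨hW s hs, ε * (s + y₀), ?_, ?_, ?_, ?_⟩
  · obtain ⟨l, r⟩ := hs
    rcases hy with ⟨rfl, rfl⟩ | ⟨rfl, rfl⟩ <;> constructor <;> linarith
  · rw [hz s hs]
    rcases hy with ⟨rfl, rfl⟩ | ⟨rfl, rfl⟩ <;> norm_num
  · rcases hy with ⟨rfl, rfl⟩ | ⟨rfl, rfl⟩
    · have h := m1 hs i1
      simp only [hB 1 i1 h1 (by norm_num), add_zero] at h
      simp only [one_mul, add_zero]
      linarith
    · have h := m1 hs i0
      simp only [hB 0 i0 h0 (by norm_num), zero_add] at h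
      rw [show -1 * (-1 * (s + -1)) = s + -1 by ring]
      linarith
  · rcases hy with ⟨rfl, rfl⟩ | ⟨rfl, rfl⟩
    · have h := m2 hs i0
      simp only [hA 0 i0 h0 (by norm_num)] at h
      linarith
    · have h := m2 hs i1
      simp only [hA 1 i1 h1 (by norm_num)] at h
      linarith

/-- The matching cycles of the segments `[0, 1]` and `[-1, 0]` are the spheres cut out by the
moments. -/
lemma matchingCycle_eq (t : ℝ) {y₀ : ℝ} (hy : ε = 1 ∧ y₀ = 0 ∨ ε = -1 ∧ y₀ = -1) :
    matchingCycle (omega t) (fun s => ((s + y₀ : ℝ) : ℂ)) = momentSphere t ε := by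
  have hε : ε = 1 ∨ ε = -1 := by tauto
  have hε2 : ε ^ 2 = 1 := by rcases hε with rfl | rfl <;> norm_num
  ext w
  constructor
  · rintro ⟨c, hc, h0, h1, s, hs, rfl⟩
    exact hc.mem_momentSphere hy h0 h1 hs
  · intro hw
    obtain ⟨⟨p, q⟩, hpq, rfl⟩ := exists_of_mem_momentSphere hε hw
    obtain ⟨e₁, he₁, hp⟩ := exists_eq_sqrt_mul p
    obtain ⟨e₂, he₂, hq⟩ := exists_eq_sqrt_mul q
    simp only at hpq
    have hX : ∀ s ∈ Icc (0 : ℝ) 1, ε * (s + y₀) ∈ Icc (0 : ℝ) 1 := fun s ⟨l, r⟩ => by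
      rcases hy with ⟨rfl, rfl⟩ | ⟨rfl, rfl⟩ <;> constructor <;> linarith
    have hX' : ∀ s ∈ Ioo (0 : ℝ) 1, ε * (s + y₀) ∈ Ioo (0 : ℝ) 1 := fun s ⟨l, r⟩ => by
      rcases hy with ⟨rfl, rfl⟩ | ⟨rfl, rfl⟩ <;> constructor <;> linarith
    have hN1 : ∀ s ∈ Icc (0 : ℝ) 1, Complex.normSq (√(1 - ε * (s + y₀)) * e₁) = 1 - ε * (s + y₀) :=
      fun s hs => normSq_sqrt_mul (by linarith [(hX s hs).2]) he₁
    have hN2 : ∀ s ∈ Icc (0 : ℝ) 1, Complex.normSq (√(ε * (s + y₀)) * e₂) = ε * (s + y₀) :=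
      fun s hs => normSq_sqrt_mul (hX s hs).1 he₂
    set c : ℝ → Amb := fun s =>
      sphereModel t ε (√(1 - ε * (s + y₀)) * e₁, √(ε * (s + y₀)) * e₂) with hcdef
    have hmem : ∀ s ∈ Icc (0 : ℝ) 1, c s ∈ W₀ := fun s hs =>
      (sphereModel_mem t hε (by simp only [hN1 s hs, hN2 s hs]; ring)).1
    have hcr : ∀ s ∈ Icc (0 : ℝ) 1, s = 0 ∨ s = 1 → c s ∈ criticalSet := fun s hs h => by
      refine (mem_criticalSet (hmem s hs)).2 ?_
      have : ε * (s + y₀) = 0 ∨ ε * (s + y₀) = 1 := by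
        rcases h with rfl | rfl <;> rcases hy with ⟨rfl, rfl⟩ | ⟨rfl, rfl⟩ <;> norm_num
      rcases this with h | h
      · right; simp [hcdef, sphereModel, h]
      · left; simp [hcdef, sphereModel, h]
    have i0 : (0 : ℝ) ∈ Icc (0 : ℝ) 1 := ⟨le_rfl, zero_le_one⟩
    have i1 : (1 : ℝ) ∈ Icc (0 : ℝ) 1 := ⟨zero_le_one, le_rfl⟩
    have hqn : ε * (ε * Complex.normSq q - y₀ + y₀) = Complex.normSq q := by
      linear_combination Complex.normSq q * hε2
    refine ⟨c, ⟨?_, fun s hs => ⟨hmem s hs, ?_⟩, fun s hs => ?_⟩, hcr 0 i0 (.inl rfl),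
      hcr 1 i1 (.inr rfl), ε * Complex.normSq q - y₀, ?_, ?_⟩
    · exact ((contDiff_sphereModel t hε).continuous.comp (by fun_prop)).continuousOn
    · change ((ε * Complex.normSq (√(ε * (s + y₀)) * e₂) : ℝ) : ℂ) = _
      rw [hN2 s hs]
      congr 1
      linear_combination (s + y₀) * hε2
    · exact exists_radial_velocity t hε y₀ he₁ he₂ (hX' s hs)
        (by filter_upwards [Ioo_mem_nhds hs.1 hs.2] with s' hs' using
          hmem s' (Ioo_subset_Icc_self hs'))
    · have l := Complex.normSq_nonneg q
      have r : Complex.normSq q ≤ 1 := by linarith [Complex.normSq_nonneg p]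
      rcases hy with ⟨rfl, rfl⟩ | ⟨rfl, rfl⟩ <;> constructor <;> linarith
    · simp only [hcdef, hqn]
      rw [← hq, ← hpq, add_sub_cancel_right, ← hp]

lemma coreRight_eq (t : ℝ) : coreRight (omega t) = momentSphere t 1 := by
  rw [← matchingCycle_eq t (.inl ⟨rfl, rfl⟩), coreRight]
  simp

lemma coreLeft_eq (t : ℝ) : coreLeft (omega t) = momentSphere t (-1) := by
  rw [← matchingCycle_eq t (.inr ⟨rfl, rfl⟩), coreLeft]
  simp [sub_eq_add_neg]

/-! ### The critical cylinder -/

lemma cyl_fst_mul_snd (p : ℝ × Circle) : cyl p 0 * cyl p 1 = -1 := by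
  have h1 : (Real.exp (Real.arsinh p.1 / 2) : ℂ) * (Real.exp (-(Real.arsinh p.1 / 2)) : ℂ) = 1 := by
    rw [← Complex.ofReal_mul, ← Real.exp_add]; simp
  have h2 : (p.2 : ℂ) * ((p.2⁻¹ : Circle) : ℂ) = 1 := by
    rw [← Circle.coe_mul]; simp
  simp only [cyl, Matrix.cons_val_zero, Matrix.cons_val_one]
  linear_combination -(p.2 : ℂ) * ((p.2⁻¹ : Circle) : ℂ) * h1 - h2

lemma cyl_mem (p : ℝ × Circle) : cyl p ∈ criticalSet ∩ fibre 0 := by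
  have hW : cyl p ∈ W₀ := ⟨by rw [cyl_fst_mul_snd]; simp [cyl], by simp [cyl]⟩
  exact ⟨(mem_criticalSet hW).2 (.inr ⟨rfl, rfl⟩), hW, rfl⟩

/-- The first coordinate of the cylinder is half the moment `|u₁|² - |v₁|²`. -/
lemma cyl_moment (p : ℝ × Circle) :
    Complex.normSq (cyl p 0) - Complex.normSq (cyl p 1) = 2 * p.1 := by
  have hc : ∀ z : Circle, Complex.normSq z = 1 := fun z => Circle.normSq_coe z
  simp only [cyl, Matrix.cons_val_zero, Matrix.cons_val_one, Complex.normSq_neg,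
    Complex.normSq_mul, Complex.normSq_ofReal, hc]
  rw [← Real.exp_add, ← Real.exp_add, show Real.arsinh p.1 / 2 + Real.arsinh p.1 / 2
    = Real.arsinh p.1 by ring, show -(Real.arsinh p.1 / 2) + -(Real.arsinh p.1 / 2)
    = -Real.arsinh p.1 by ring]
  have h := Real.sinh_arsinh p.1
  rw [Real.sinh_eq] at h
  linarith

lemma exists_cyl_eq {w : Amb} (hw : w ∈ criticalSet ∩ fibre 0) : ∃ p, cyl p = w := by
  obtain ⟨hc, hW, h4⟩ := hw
  have h01 := hW.1
  rw [h4] at h01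
  have h0 : w 0 ≠ 0 := by rintro h; rw [h] at h01; norm_num at h01
  obtain ⟨h2, h3⟩ : w 2 = 0 ∧ w 3 = 0 := by
    rcases (mem_criticalSet hW).1 hc with ⟨h, -⟩ | h
    · exact absurd h h0
    · exact h
  have hn : 0 < ‖w 0‖ := norm_pos_iff.2 h0
  have hnC : (‖w 0‖ : ℂ) ≠ 0 := by exact_mod_cast hn.ne'
  let e : Circle := ⟨w 0 / ‖w 0‖, by simp [Submonoid.unitSphere, hn.ne']⟩
  have he : (e : ℂ) = w 0 / ‖w 0‖ := rfl
  have hr : Real.exp (Real.arsinh (Real.sinh (2 * Real.log ‖w 0‖)) / 2) = ‖w 0‖ := by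
    rw [Real.arsinh_sinh, mul_div_cancel_left₀ _ (two_ne_zero' ℝ), Real.exp_log hn]
  refine ⟨(Real.sinh (2 * Real.log ‖w 0‖), e), ?_⟩
  have c0 : cyl (Real.sinh (2 * Real.log ‖w 0‖), e) 0 = w 0 := by
    simp only [cyl, Matrix.cons_val_zero, hr, he]
    field_simp
  have c1 : cyl (Real.sinh (2 * Real.log ‖w 0‖), e) 1 = w 1 := by
    have := cyl_fst_mul_snd (Real.sinh (2 * Real.log ‖w 0‖), e)
    rw [c0] at this
    refine mul_left_cancel₀ h0 ?_
    rw [this, h01]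
    norm_num
  ext i
  fin_cases i
  exacts [c0, c1, h2.symm, h3.symm, h4.symm]

lemma injective_cyl : Function.Injective cyl := by
  rintro ⟨r, e⟩ ⟨r', e'⟩ h
  have hr : r = r' := by
    have h1 := cyl_moment (r, e)
    rw [h, cyl_moment] at h1
    simpa using h1.symm
  have h0 := congrFun h 0
  rw [← hr] at h0
  simp only [cyl, Matrix.cons_val_zero] at h0
  have hne : (Real.exp (Real.arsinh r / 2) : ℂ) ≠ 0 := by exact_mod_cast (Real.exp_pos _).ne'
  exact Prod.ext hr (Circle.ext (mul_left_cancel₀ hne h0))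

lemma cyl_exp (r θ : ℝ) : cyl (r, Circle.exp θ) =
    ![Complex.exp ((Real.arsinh r / 2 : ℝ) + θ * Complex.I),
      -Complex.exp (-((Real.arsinh r / 2 : ℝ) + θ * Complex.I)), 0, 0, 0] := by
  simp only [cyl, ← Circle.exp_neg, Circle.coe_exp, Complex.ofReal_exp, ← Complex.exp_add]
  push_cast
  ring_nf

lemma omega_cyl (t r θ : ℝ) : omega t (cyl (r, Circle.exp θ))
    ![deriv (fun r' => cyl (r', Circle.exp θ)) r,
      deriv (fun θ' => cyl (r, Circle.exp θ')) θ] = 1 := by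
  set E : ℂ := (Real.arsinh r / 2 : ℝ) + θ * Complex.I with hE
  set a : ℝ := (√(1 + r ^ 2))⁻¹ / 2 with ha
  have hr : HasDerivAt (fun r : ℝ => ((Real.arsinh r / 2 : ℝ) + θ * Complex.I : ℂ)) a r :=
    ((Real.hasDerivAt_arsinh r).div_const 2).ofReal_comp.add_const _
  have hθ : HasDerivAt (fun θ : ℝ => ((Real.arsinh r / 2 : ℝ) + θ * Complex.I : ℂ))
      Complex.I θ := by
    simpa using ((hasDerivAt_id θ).ofReal_comp.mul_const Complex.I).const_add
      ((Real.arsinh r / 2 : ℝ) : ℂ)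
  have d : ∀ {f : ℝ → ℂ} {f' : ℂ} {s : ℝ}, HasDerivAt f f' s →
      HasDerivAt (fun s => (![Complex.exp (f s), -Complex.exp (-f s), 0, 0, 0] : Amb))
        ![Complex.exp (f s) * f', Complex.exp (-f s) * f', 0, 0, 0] s := fun {f f' s} h => by
    refine hasDerivAt_pi.2 fun i => ?_
    fin_cases i
    · exact h.cexp
    · exact h.neg.cexp.neg.congr_deriv (by simp)
    · exact hasDerivAt_const _ _
    · exact hasDerivAt_const _ _
    · exact hasDerivAt_const _ _
  simp only [cyl_exp]
  rw [(d hr).deriv, (d hθ).deriv, ← hE, omega_apply, Fin.sum_univ_five]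
  have n1 : (Complex.exp E).re ^ 2 + (Complex.exp E).im ^ 2 = Real.exp (Real.arsinh r) := by
    have h := Complex.normSq_apply (Complex.exp E)
    rw [Complex.normSq_eq_norm_sq, Complex.norm_exp, ← Real.exp_nat_mul] at h
    have : ((2 : ℕ) : ℝ) * E.re = Real.arsinh r := by simp [hE]; ring
    rw [this] at h
    linarith
  have n2 : (Complex.exp (-E)).re ^ 2 + (Complex.exp (-E)).im ^ 2
      = Real.exp (-Real.arsinh r) := by
    have h := Complex.normSq_apply (Complex.exp (-E))
    rw [Complex.normSq_eq_norm_sq, Complex.norm_exp, ← Real.exp_nat_mul] at h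
    have : ((2 : ℕ) : ℝ) * (-E).re = -Real.arsinh r := by simp [hE]; ring
    rw [this] at h
    linarith
  have hcosh := Real.cosh_arsinh r
  rw [Real.cosh_eq] at hcosh
  have hs : √(1 + r ^ 2) ≠ 0 := (Real.sqrt_pos.2 (by positivity)).ne'
  have h1 : a * (Real.exp (Real.arsinh r) + Real.exp (-Real.arsinh r)) = 1 := by
    rw [ha, ← hcosh] at *
    field_simp
  simp
  linear_combination a * n1 + a * n2 + h1

lemma isSymplecticCylinder_omega (t : ℝ) : IsSymplecticCylinder (omega t) where
  bijOn := ⟨fun p _ => cyl_mem p, injective_cyl.injOn, fun w hw => by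
    obtain ⟨p, hp⟩ := exists_cyl_eq hw
    exact ⟨p, mem_univ _, hp⟩⟩
  smooth := by
    simp only [cyl_exp]
    have h : ContDiff ℝ ∞ fun q : ℝ × ℝ => ((Real.arsinh q.1 / 2 : ℝ) + q.2 * Complex.I : ℂ) :=
      (Complex.ofRealCLM.contDiff.comp ((Real.contDiff_arsinh.comp contDiff_fst).div_const 2)).add
        ((Complex.ofRealCLM.contDiff.comp contDiff_snd).mul contDiff_const)
    rw [contDiff_pi]
    intro i
    fin_cases i
    exacts [h.cexp, h.neg.cexp.neg, contDiff_const, contDiff_const, contDiff_const]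
  area r θ := omega_cyl t r θ

lemma momentSphere_inter_fibre (t : ℝ) {ε : ℝ} (hε : ε = 1 ∨ ε = -1) :
    momentSphere t ε ∩ fibre 0 = cyl '' ({t * cutoff ε} ×ˢ univ) := by
  have hε0 : ε ≠ 0 := by rcases hε with rfl | rfl <;> norm_num
  have hχ0 : cutoff 0 = 0 := cutoff_of_le (by norm_num)
  ext w
  constructor
  · rintro ⟨⟨hW, x, -, hx, hm, h23⟩, -, h4⟩
    have hx0 : x = 0 := by
      rw [hx, Complex.ofReal_eq_zero] at h4
      simpa [hε0] using h4
    rw [hx0, mul_zero, hχ0] at hm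
    have h2 : w 2 = 0 ∧ w 3 = 0 := by
      have := hW.2
      rw [h4] at this
      rcases mul_eq_zero.1 this with h | h
      · exact ⟨h, Complex.normSq_eq_zero.1 (by rw [← h23, h, map_zero])⟩
      · exact ⟨Complex.normSq_eq_zero.1 (by rw [h23, h, map_zero]), h⟩
    obtain ⟨p, rfl⟩ := exists_cyl_eq ⟨(mem_criticalSet hW).2 (.inr h2), hW, h4⟩
    refine ⟨p, ⟨?_, mem_univ _⟩, rfl⟩
    rw [cyl_moment] at hm
    simpa using hm
  · rintro ⟨p, ⟨hp, -⟩, rfl⟩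
    refine ⟨⟨(cyl_mem p).2.1, 0, ⟨le_rfl, zero_le_one⟩, ?_, ?_, rfl⟩, (cyl_mem p).2⟩
    · simp [cyl]
    · rw [cyl_moment, show p.1 = t * cutoff ε from hp, mul_zero, hχ0, sub_zero]

lemma disjoint_momentSphere {t : ℝ} (ht : t ≠ 0) :
    Disjoint (momentSphere t (-1)) (momentSphere t 1) := by
  rw [Set.disjoint_left]
  rintro w ⟨-, x, ⟨hx0, -⟩, hx, hm, -⟩ ⟨-, x', ⟨hx0', -⟩, hx', hm', -⟩
  rw [hx, Complex.ofReal_inj] at hx'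
  have h0 : x = 0 := by linarith
  have h0' : x' = 0 := by linarith
  rw [hm, h0, h0', mul_zero, mul_zero, cutoff_of_le (x := -1) (by norm_num),
    cutoff_of_ge (x := 1) (by norm_num), cutoff_of_le (x := 0) (by norm_num)] at hm'
  exact ht (by linarith)

end InexactPlumbing

theorem mainTheorem9 (t : ℝ) (ht : t ≠ 0) :
    -- `ω_t` is a symplectic form on `W₀`, and it is inexact
    InexactPlumbing.IsSymplectic (InexactPlumbing.omega t) ∧
    ¬ InexactPlumbing.IsExact (InexactPlumbing.omega t) ∧
    -- the two cores are Lagrangian 3-spheres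
    InexactPlumbing.IsLagrangianSphere (InexactPlumbing.omega t)
      (InexactPlumbing.coreLeft (InexactPlumbing.omega t)) ∧
    InexactPlumbing.IsLagrangianSphere (InexactPlumbing.omega t)
      (InexactPlumbing.coreRight (InexactPlumbing.omega t)) ∧
    -- they are disjoint
    Disjoint (InexactPlumbing.coreLeft (InexactPlumbing.omega t))
      (InexactPlumbing.coreRight (InexactPlumbing.omega t)) ∧
    -- they meet the central fibre in circles which differ by the translation of flux `t`
    InexactPlumbing.IsSymplecticCylinder (InexactPlumbing.omega t) ∧
    InexactPlumbing.coreLeft (InexactPlumbing.omega t) ∩ InexactPlumbing.fibre 0 =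
      InexactPlumbing.cyl '' ({0} ×ˢ Set.univ) ∧
    InexactPlumbing.coreRight (InexactPlumbing.omega t) ∩ InexactPlumbing.fibre 0 =
      InexactPlumbing.cyl '' (InexactPlumbing.fluxTranslation t '' ({0} ×ˢ Set.univ)) := by
  open InexactPlumbing in
  have hflux : fluxTranslation t '' ({0} ×ˢ Set.univ) = {t} ×ˢ Set.univ := by
    ext ⟨r, e⟩
    simp [fluxTranslation, eq_comm]
  rw [hflux, coreLeft_eq, coreRight_eq, momentSphere_inter_fibre t (.inr rfl),
    momentSphere_inter_fibre t (.inl rfl), cutoff_of_le (x := -1) (by norm_num),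
    cutoff_of_ge (x := 1) (by norm_num), mul_zero, mul_one]
  exact ⟨isSymplectic_omega t, not_isExact_omega ht, isLagrangianSphere_momentSphere t (.inr rfl),
    isLagrangianSphere_momentSphere t (.inl rfl), disjoint_momentSphere ht,
    isSymplecticCylinder_omega t, rfl, rfl⟩
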